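/- Let $\beta\in[0,2)$. In the tilted-CHSH game with parameter $\beta$, Alice and Bob receive inputs $x\in\{0,1\}$ and $y\in\{0,1,2\}$ with probability $p(x,y)=\frac{1}{4+\beta}$ if $y\in\{0,1\}$, $p(0,2)=\frac{\beta}{4+\beta}$ and $p(1,2)=0$; they answer $a,b\in\{0,1\}$, and they win if either $y\in\{0,1\}$ and $a\oplus b=xy$, or $(x,y)=(0,2)$ and $a=0$. Let $\omega_{\mathrm q}=\frac12+\frac{\sqrt{8+2\beta^2}}{8+2\beta}$ be the maximal quantum winning probability, and let $\theta\in(0,\pi/4]$ be given by $\tan 2\theta=\sqrt{2/\beta^2-1/2}$ (with $\theta=\pi/4$ for $\beta=0$). There is a constant $\kappa$, depending only on $\beta$, with $$\kappa\le \frac{4\sqrt{4+\beta}\,(4\sqrt2+61)}{\ln 2}\le 385\sqrt{4+\beta},$$ such that the following holds. Let $\mathcal H_A,\mathcal H_B,\mathcal H_E$ be complex Hilbert spaces of arbitrary dimension, let $\rho$ be a density operator on $\mathcal H_A\otimes\mathcal H_B\otimes\mathcal H_E$, and let $\{P_{a|x}\}_{a\in\{0,1\}}$ on $\mathcal H_A$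 ($x\in\{0,1\}$) and $\{Q_{b|y}\}_{b\in\{0,1\}}$ on $\mathcal H_B$ ($y\in\{0,1,2\}$) be POVMs. Let $\omega=\sum_{a,b,x,y}V(a,b,x,y)\,p(x,y)\,\mathrm{tr}\big(\rho\,(P_{a|x}\otimes Q_{b|y}\otimes 1)\big)$ be the expected winning probability, where $V$ is $1$ if the game is won and $0$ otherwise. Then $\omega\le\omega_{\mathrm q}$ and $$H_{\min}(A|E;X=1)\ \ge\ 1-\kappa\,\theta^{-4}\sqrt{\omega_{\mathrm q}-\omega}.$$ Here $H_{\min}(A|E;X=1)$ is the conditional min-entropy of the state $\rho_{AE}=\sum_a |a\rangle\langle a|\otimes \mathrm{tr}_{AB}\big((P_{a|1}\otimes 1\otimes 1)\rho\big)$ of Alice's outcome for input $x=1$ and the environment, that is, the supremum of the real numbers $h$ for which there is a density operator $\sigma$ on $\mathcal H_E$ with $\rho_{AE}\le 2^{-h}\,1\otimes\sigma$. -/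

import Mathlib

open scoped TensorProduct InnerProductSpace

noncomputable section

namespace TiltedCHSH

/-! ### Hilbert space tensor products -/

section Tensor

variable {H K : Type*} [NormedAddCommGroup H] [InnerProductSpace ℂ H] [CompleteSpace H]
  [NormedAddCommGroup K] [InnerProductSpace ℂ K] [CompleteSpace K]

/-- The Hilbert space tensor product: the completion of the algebraic tensor product for the
inner product with `⟪x ⊗ y, x' ⊗ y'⟫ = ⟪x, x'⟫ * ⟪y, y'⟫`. -/
abbrev HTensor (H K : Type*) [NormedAddCommGroup H] [InnerProductSpace ℂ H]
    [NormedAddCommGroup K] [InnerProductSpace ℂ K] : Type _ :=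
  UniformSpace.Completion (H ⊗[ℂ] K)

theorem inner_map_left (S : H →L[ℂ] H) (T : K →L[ℂ] K) (x y : H ⊗[ℂ] K) :
    ⟪TensorProduct.map (S : H →ₗ[ℂ] H) (T : K →ₗ[ℂ] K) x, y⟫_ℂ =
      ⟪x, TensorProduct.map ((star S : H →L[ℂ] H) : H →ₗ[ℂ] H)
        ((star T : K →L[ℂ] K) : K →ₗ[ℂ] K) y⟫_ℂ := by
  induction x using TensorProduct.induction_on with
  | zero => simp
  | add x₁ x₂ h₁ h₂ => simp only [map_add, inner_add_left, h₁, h₂]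
  | tmul a b =>
    induction y using TensorProduct.induction_on with
    | zero => simp
    | add y₁ y₂ h₁ h₂ => simp only [map_add, inner_add_right, h₁, h₂]
    | tmul c d =>
      simp [ContinuousLinearMap.star_eq_adjoint, ContinuousLinearMap.adjoint_inner_right]

theorem inner_map_map_self (S : H →L[ℂ] H) (T : K →L[ℂ] K) (x : H ⊗[ℂ] K) :
    ⟪TensorProduct.map (S : H →ₗ[ℂ] H) (T : K →ₗ[ℂ] K) x,
      TensorProduct.map (S : H →ₗ[ℂ] H) (T : K →ₗ[ℂ] K) x⟫_ℂ =
      ⟪x, TensorProduct.map ((star S * S : H →L[ℂ] H) : H →ₗ[ℂ] H)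
        ((star T * T : K →L[ℂ] K) : K →ₗ[ℂ] K) x⟫_ℂ := by
  rw [inner_map_left, ← LinearMap.comp_apply, ← TensorProduct.map_comp]
  rfl

theorem exists_complement (T : H →L[ℂ] H) :
    ∃ R : H →L[ℂ] H, star T * T + star R * R = ((‖T‖ ^ 2 : ℝ) : ℂ) • (1 : H →L[ℂ] H) := by
  have h := CStarAlgebra.star_mul_le_algebraMap_norm_sq (a := T)
  obtain ⟨R, hR⟩ := CStarAlgebra.nonneg_iff_eq_star_mul_self.mp (sub_nonneg.mpr h)
  refine ⟨R, ?_⟩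
  rw [← hR, add_sub_cancel]
  ext x
  simp only [Algebra.algebraMap_eq_smul_one, smul_apply]
  exact RCLike.real_smul_eq_coe_smul (K := ℂ) _ _

theorem norm_map_left_le (S : H →L[ℂ] H) (x : H ⊗[ℂ] K) :
    ‖TensorProduct.map (S : H →ₗ[ℂ] H) ((1 : K →L[ℂ] K) : K →ₗ[ℂ] K) x‖ ≤ ‖S‖ * ‖x‖ := by
  obtain ⟨R, hR⟩ := exists_complement S
  have e : TensorProduct.map ((star S * S : H →L[ℂ] H) : H →ₗ[ℂ] H)
        ((star (1 : K →L[ℂ] K) * 1 : K →L[ℂ] K) : K →ₗ[ℂ] K) x +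
      TensorProduct.map ((star R * R : H →L[ℂ] H) : H →ₗ[ℂ] H)
        ((star (1 : K →L[ℂ] K) * 1 : K →L[ℂ] K) : K →ₗ[ℂ] K) x =
      ((‖S‖ ^ 2 : ℝ) : ℂ) • x := by
    induction x using TensorProduct.induction_on with
    | zero => simp
    | add y z hy hz => rw [map_add, map_add, add_add_add_comm, hy, hz, smul_add]
    | tmul a b =>
      have h := congrArg (fun T : H →L[ℂ] H => T a) hR
      simp only [add_apply, smul_apply, one_apply_eq_self] at h
      simp only [TensorProduct.map_tmul, ← TensorProduct.add_tmul, ContinuousLinearMap.coe_coe, h,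
        TensorProduct.smul_tmul']
      simp
  have h := congrArg₂ (· + ·) (inner_map_map_self S (1 : K →L[ℂ] K) x)
    (inner_map_map_self R (1 : K →L[ℂ] K) x)
  have h := h.trans ((inner_add_right x _ _).symm.trans ((congrArg (inner ℂ x) e).trans
    (inner_smul_right x x _)))
  have h' := ((congrArg₂ (· + ·) 
      (inner_self_eq_norm_sq_to_K (𝕜 := ℂ)
        (TensorProduct.map (S : H →ₗ[ℂ] H) ((1 : K →L[ℂ] K) : K →ₗ[ℂ] K) x)).symm
      (inner_self_eq_norm_sq_to_K (𝕜 := ℂ)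
        (TensorProduct.map (R : H →ₗ[ℂ] H) ((1 : K →L[ℂ] K) : K →ₗ[ℂ] K) x)).symm).trans h).trans
    (congrArg (((‖S‖ ^ 2 : ℝ) : ℂ) * ·) (inner_self_eq_norm_sq_to_K (𝕜 := ℂ) x))
  have h'' : ‖TensorProduct.map (S : H →ₗ[ℂ] H) ((1 : K →L[ℂ] K) : K →ₗ[ℂ] K) x‖ ^ 2 +
      ‖TensorProduct.map (R : H →ₗ[ℂ] H) ((1 : K →L[ℂ] K) : K →ₗ[ℂ] K) x‖ ^ 2 =
      ‖S‖ ^ 2 * ‖x‖ ^ 2 := by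
    apply Complex.ofReal_injective
    push_cast at h' ⊢
    exact h'
  rw [← sq_le_sq₀ (norm_nonneg _) (by positivity), mul_pow]
  exact (le_add_of_nonneg_right (sq_nonneg _)).trans h''.le

theorem norm_map_right_le (T : K →L[ℂ] K) (x : H ⊗[ℂ] K) :
    ‖TensorProduct.map ((1 : H →L[ℂ] H) : H →ₗ[ℂ] H) (T : K →ₗ[ℂ] K) x‖ ≤ ‖T‖ * ‖x‖ := by
  have h : TensorProduct.map ((1 : H →L[ℂ] H) : H →ₗ[ℂ] H) (T : K →ₗ[ℂ] K) x =
      TensorProduct.comm ℂ K H (TensorProduct.map (T : K →ₗ[ℂ] K)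
        ((1 : H →L[ℂ] H) : H →ₗ[ℂ] H) (TensorProduct.comm ℂ H K x)) := by
    induction x using TensorProduct.induction_on with
    | zero => simp
    | add y z hy hz => simp only [map_add, hy, hz]
    | tmul a b => simp
  rw [h, TensorProduct.norm_comm]
  exact (norm_map_left_le T _).trans_eq (by rw [TensorProduct.norm_comm])

theorem norm_map_le (S : H →L[ℂ] H) (T : K →L[ℂ] K) (x : H ⊗[ℂ] K) :
    ‖TensorProduct.map (S : H →ₗ[ℂ] H) (T : K →ₗ[ℂ] K) x‖ ≤ ‖S‖ * ‖T‖ * ‖x‖ := by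
  have h : TensorProduct.map (S : H →ₗ[ℂ] H) (T : K →ₗ[ℂ] K) x =
      TensorProduct.map (S : H →ₗ[ℂ] H) ((1 : K →L[ℂ] K) : K →ₗ[ℂ] K)
        (TensorProduct.map ((1 : H →L[ℂ] H) : H →ₗ[ℂ] H) (T : K →ₗ[ℂ] K) x) := by
    rw [← LinearMap.comp_apply, ← TensorProduct.map_comp]
    rfl
  rw [h, mul_assoc]
  exact (norm_map_left_le S _).trans
    (mul_le_mul_of_nonneg_left (norm_map_right_le T x) (norm_nonneg S))

/-- The bounded operator `S ⊗ T` on the Hilbert space tensor product: the continuous extension of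
`x ⊗ y ↦ S x ⊗ T y`. -/
def tensorOp (S : H →L[ℂ] H) (T : K →L[ℂ] K) : HTensor H K →L[ℂ] HTensor H K :=
  (LinearMap.mkContinuous (TensorProduct.map (S : H →ₗ[ℂ] H) (T : K →ₗ[ℂ] K)) (‖S‖ * ‖T‖)
    (norm_map_le S T)).completion

end Tensor

/-! ### States and measurements -/

section States

/-- The trace `∑ i, ⟪e i, T (e i)⟫` over a Hilbert basis `e`. For a trace-class operator, in
particular for `ρ * M` with `ρ` a density operator and `M` bounded, the sum converges absolutely
and does not depend on the basis. -/
def trace {H : Type*} [NormedAddCommGroup H] [InnerProductSpace ℂ H] [CompleteSpace H]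
    (T : H →L[ℂ] H) : ℂ :=
  ∑' i : (exists_hilbertBasis ℂ H).choose,
    ⟪(exists_hilbertBasis ℂ H).choose_spec.choose i,
      T ((exists_hilbertBasis ℂ H).choose_spec.choose i)⟫_ℂ

/-- A density operator: a positive bounded operator of trace one (a divergent sum would be `0`, so
such an operator is trace class). -/
structure DensityOperator (H : Type*) [NormedAddCommGroup H] [InnerProductSpace ℂ H]
    [CompleteSpace H] where
  op : H →L[ℂ] H
  isPositive : op.IsPositive
  trace_eq_one : trace op = 1

/-- The expectation value `tr (ρ M)` of a self-adjoint bounded operator `M`, as a real number. -/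
def DensityOperator.expect {H : Type*} [NormedAddCommGroup H] [InnerProductSpace ℂ H]
    [CompleteSpace H] (ρ : DensityOperator H) (M : H →L[ℂ] H) : ℝ :=
  (trace (ρ.op * M)).re

/-- A measurement (POVM) with outcomes in `{0, 1}`. -/
structure Measurement (H : Type*) [NormedAddCommGroup H] [InnerProductSpace ℂ H]
    [CompleteSpace H] where
  effect : Fin 2 → H →L[ℂ] H
  isPositive : ∀ a, (effect a).IsPositive
  sum_eq_one : ∑ a, effect a = 1

end States

/-! ### The game -/

section Game

/-- The input distribution `p(x, y)`. -/
def inputDist (β : ℝ) (x : Fin 2) (y : Fin 3) : ℝ :=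
  if y = 0 ∨ y = 1 then 1 / (4 + β) else if x = 0 then β / (4 + β) else 0

/-- The predicate `V(a, b, x, y)`, as a number in `{0, 1}`. -/
def predicate (a b x : Fin 2) (y : Fin 3) : ℝ :=
  if y = 0 ∨ y = 1 then
    if (a.val + b.val) % 2 = x.val * y.val then 1 else 0
  else if x = 0 ∧ a = 0 then 1 else 0

/-- The maximal quantum winning probability `ω_q`. -/
def quantumValue (β : ℝ) : ℝ :=
  1 / 2 + √(8 + 2 * β ^ 2) / (8 + 2 * β)

/-- The angle `θ ∈ (0, π/4]` with `tan (2 θ) = √(2 / β ^ 2 - 1 / 2)`, where `β = 0` corresponds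
to an infinite tangent, that is, to `θ = π / 4`. -/
def angle (β : ℝ) : ℝ :=
  if β = 0 then Real.pi / 4 else Real.arctan (√(2 / β ^ 2 - 1 / 2)) / 2

end Game

/-! ### Devices entangled with an environment -/

section Devices

/-- A pair of quantum devices with internal Hilbert spaces `HA`, `HB` and an environment `HE`:
a joint state on `HA ⊗ HB ⊗ HE` and, for each input, a local measurement. -/
structure Devices (HA HB HE : Type*)
    [NormedAddCommGroup HA] [InnerProductSpace ℂ HA] [CompleteSpace HA]
    [NormedAddCommGroup HB] [InnerProductSpace ℂ HB] [CompleteSpace HB]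
    [NormedAddCommGroup HE] [InnerProductSpace ℂ HE] [CompleteSpace HE] where
  state : DensityOperator (HTensor (HTensor HA HB) HE)
  alice : Fin 2 → Measurement HA
  bob : Fin 3 → Measurement HB

variable {HA HB HE : Type*}
  [NormedAddCommGroup HA] [InnerProductSpace ℂ HA] [CompleteSpace HA]
  [NormedAddCommGroup HB] [InnerProductSpace ℂ HB] [CompleteSpace HB]
  [NormedAddCommGroup HE] [InnerProductSpace ℂ HE] [CompleteSpace HE]

/-- The probability `p(a, b | x, y)` of the outputs, by the Born rule. -/
def Devices.prob (D : Devices HA HB HE) (a b x : Fin 2) (y : Fin 3) : ℝ :=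
  D.state.expect (tensorOp (tensorOp ((D.alice x).effect a) ((D.bob y).effect b)) 1)

/-- The expected winning probability `ω` in the game with parameter `β`. -/
def Devices.winProb (D : Devices HA HB HE) (β : ℝ) : ℝ :=
  ∑ a, ∑ b, ∑ x, ∑ y, predicate a b x y * inputDist β x y * D.prob a b x y

/-- When Alice measures with input `x`, the joint state of her outcome and the environment is the
classical-quantum state `∑ a, |a⟩⟨a| ⊗ ρ a`, with
`ρ a = tr_AB ((effect a ⊗ 1 ⊗ 1) ρ)` a subnormalized state of the environment. This is the
quadratic form `⟪v, ρ a v⟫ = tr (ρ (effect a ⊗ 1 ⊗ |v⟩⟨v|))` of `ρ a`. -/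
def Devices.envForm (D : Devices HA HB HE) (x a : Fin 2) (v : HE) : ℝ :=
  D.state.expect
    (tensorOp (tensorOp ((D.alice x).effect a) 1) (InnerProductSpace.rankOne ℂ v v))

/-- The conditional min-entropy `H_min(A | E; X = x)`: the supremum of the real numbers `h` for
which there is a density operator `σ` of the environment with `ρ_AE ≤ 2 ^ (-h) • (1 ⊗ σ)`. As
`ρ_AE` is block diagonal, this says `ρ a ≤ 2 ^ (-h) • σ` for each outcome `a`. -/
def Devices.minEntropy (D : Devices HA HB HE) (x : Fin 2) : EReal :=
  sSup {t : EReal | ∃ h : ℝ, t = (h : EReal) ∧ ∃ σ : DensityOperator HE,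
    ∀ (a : Fin 2) (v : HE), D.envForm x a v ≤ (2 : ℝ) ^ (-h) * (⟪v, σ.op v⟫_ℂ).re}

end Devices

end TiltedCHSH

end

/-! Write `I` for the tilted CHSH operator of the ±1 observables and `s = √(8 + 2β²)`. The winning
probability is affine in the expectation of `I`, and `s - I` is a multiple of a sum of squares in
two different ways. This gives the quantum bound `I ≤ s`. It also shows that, on a state with small
gap `δ = s - ⟨I⟩`, every operator that is squared nearly annihilates the state. Polynomial
identities then write Alice's observable `A₁` in terms of these operators, up to skew-adjoint terms
whose expectation has no real part, so `|⟨A₁⟩| ≤ 2c√δ` with `c = 432 / (4 - β²)²`.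

By the arithmetic-geometric mean inequality this becomes a family of linear inequalities `I + t A₁ ≤
s + c²t²`. Unlike a statement about near-optimal states, they pass to compressions. Observables of
POVMs are contractions, hence compressions of reflections, so the family holds for all devices
(`Devices.isPositive_bell`).

For the entropy, the inequalities for `t` and `-t` say that one operator `N = 1 + t⁻¹(s + δ - I)`,
with `c²t² = δ`, dominates both `1 ± A₁`, that is, twice each of Alice's effects. The normalized
partial trace of `ρ(N ⊗ 1)` therefore serves as `σ` for both outcomes, and `tr(ρN) ≤ 1 + 2c√δ`
bounds the guessing probability (`Devices.le_minEntropy`). It remains to compare `(4 - β²)²` with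
`θ⁴`. -/

noncomputable section

namespace TiltedCHSH

/-! ### Polynomial identities for the tilted CHSH operator -/

section Algebra

variable {K M : Type*} [CommRing K] [Ring M] [Algebra K M]

/-- The tilted CHSH operator. -/
def bellOp (β : K) (A₀ A₁ B₀ B₁ : M) : M :=
  β • A₀ + A₀ * B₀ + A₀ * B₁ + A₁ * B₀ - A₁ * B₁

/-- With `R' = β A₁ - A₀(B₀ - B₁) - A₁(B₀ + B₁)`, this is a rearrangement of `I² + R'² = s²`. -/
theorem bellOp_sos_fst {β s : K} (hs : s ^ 2 = 8 + 2 * β ^ 2) {A₀ A₁ B₀ B₁ : M}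
    (hA₀ : A₀ * A₀ = 1) (hA₁ : A₁ * A₁ = 1) (hB₀ : B₀ * B₀ = 1) (hB₁ : B₁ * B₁ = 1)
    (h₀₀ : Commute A₀ B₀) (h₀₁ : Commute A₀ B₁) (h₁₀ : Commute A₁ B₀) (h₁₁ : Commute A₁ B₁) :
    (s • 1 - bellOp β A₀ A₁ B₀ B₁) * (s • 1 - bellOp β A₀ A₁ B₀ B₁) +
      (β • A₁ - A₀ * (B₀ - B₁) - A₁ * (B₀ + B₁)) * (β • A₁ - A₀ * (B₀ - B₁) - A₁ * (B₀ + B₁)) =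
      (2 * s) • (s • 1 - bellOp β A₀ A₁ B₀ B₁) := by
  have c₀₀ := h₀₀.eq.symm
  have c₀₁ := h₀₁.eq.symm
  have c₁₀ := h₁₀.eq.symm
  have c₁₁ := h₁₁.eq.symm
  have d₀₀ (x : M) : B₀ * (A₀ * x) = A₀ * (B₀ * x) := by rw [← mul_assoc, c₀₀, mul_assoc]
  have d₀₁ (x : M) : B₁ * (A₀ * x) = A₀ * (B₁ * x) := by rw [← mul_assoc, c₀₁, mul_assoc]
  have d₁₀ (x : M) : B₀ * (A₁ * x) = A₁ * (B₀ * x) := by rw [← mul_assoc, c₁₀, mul_assoc]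
  have d₁₁ (x : M) : B₁ * (A₁ * x) = A₁ * (B₁ * x) := by rw [← mul_assoc, c₁₁, mul_assoc]
  have e₀ (x : M) : A₀ * (A₀ * x) = x := by rw [← mul_assoc, hA₀, one_mul]
  have e₁ (x : M) : A₁ * (A₁ * x) = x := by rw [← mul_assoc, hA₁, one_mul]
  simp only [bellOp, mul_add, add_mul, sub_mul, mul_sub, smul_mul_assoc, mul_smul_comm,
    mul_one, one_mul, mul_assoc, c₀₀, c₀₁, c₁₀, c₁₁, d₀₀, d₀₁, d₁₀, d₁₁, e₀, e₁, hA₀, hA₁, hB₀, hB₁]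
  linear_combination (norm := module) -(hs • (1 : M))

/-- The second decomposition is needed because its first square, combined with `s - I`, controls `s
- 2A₀(B₀ + B₁)`. -/
theorem bellOp_sos_snd {β s : K} (hs : s ^ 2 = 8 + 2 * β ^ 2) {A₀ A₁ B₀ B₁ : M}
    (hA₀ : A₀ * A₀ = 1) (hA₁ : A₁ * A₁ = 1) (hB₀ : B₀ * B₀ = 1) (hB₁ : B₁ * B₁ = 1)
    (h₀₀ : Commute A₀ B₀) (h₀₁ : Commute A₀ B₁) (h₁₀ : Commute A₁ B₀) (h₁₁ : Commute A₁ B₁) :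
    ((4 : K) • A₀ - s • (B₀ + B₁) + β • (A₀ * (B₀ + B₁) - A₁ * (B₀ - B₁))) *
      ((4 : K) • A₀ - s • (B₀ + B₁) + β • (A₀ * (B₀ + B₁) - A₁ * (B₀ - B₁))) +
      ((4 : K) • A₁ - s • (B₀ - B₁) + β • (A₀ * (B₀ - B₁) - A₁ * (B₀ + B₁))) *
      ((4 : K) • A₁ - s • (B₀ - B₁) + β • (A₀ * (B₀ - B₁) - A₁ * (B₀ + B₁))) =
      (8 * s) • (s • 1 - bellOp β A₀ A₁ B₀ B₁) := by
  have c₀₀ := h₀₀.eq.symm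
  have c₀₁ := h₀₁.eq.symm
  have c₁₀ := h₁₀.eq.symm
  have c₁₁ := h₁₁.eq.symm
  have d₀₀ (x : M) : B₀ * (A₀ * x) = A₀ * (B₀ * x) := by rw [← mul_assoc, c₀₀, mul_assoc]
  have d₀₁ (x : M) : B₁ * (A₀ * x) = A₀ * (B₁ * x) := by rw [← mul_assoc, c₀₁, mul_assoc]
  have d₁₀ (x : M) : B₀ * (A₁ * x) = A₁ * (B₀ * x) := by rw [← mul_assoc, c₁₀, mul_assoc]
  have d₁₁ (x : M) : B₁ * (A₁ * x) = A₁ * (B₁ * x) := by rw [← mul_assoc, c₁₁, mul_assoc]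
  have e₀ (x : M) : A₀ * (A₀ * x) = x := by rw [← mul_assoc, hA₀, one_mul]
  have e₁ (x : M) : A₁ * (A₁ * x) = x := by rw [← mul_assoc, hA₁, one_mul]
  simp only [bellOp, mul_add, add_mul, sub_mul, mul_sub, smul_mul_assoc, mul_smul_comm, smul_smul,
    mul_one, mul_assoc, c₀₀, c₀₁, c₁₀, c₁₁, d₀₀, d₀₁, d₁₀, d₁₁, e₀, e₁, hA₀, hA₁, hB₀, hB₁,
    smul_add, smul_sub]
  linear_combination (norm := module) -((4 : K) • hs • (1 : M))

/-- Subtracting `β(s - I)` cancels every occurrence of `A₁`, and what is left factors as `(½ s A₀ -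
β)(s - 2A₀(B₀ + B₁))`. The factor `2β + s A₀` inverts `½ s A₀ - β` up to the scalar `s²/2 - 2β² = 4
- β²`. -/
theorem one_sub_mul_identity {β s : K} (hs : s ^ 2 = 8 + 2 * β ^ 2) {A₀ A₁ B₀ B₁ : M}
    (hA₀ : A₀ * A₀ = 1) :
    (4 - β ^ 2) • (s • 1 - (2 : K) • (A₀ * (B₀ + B₁))) =
      ((2 * β) • 1 + s • A₀) *
        (((4 : K) • A₀ - s • (B₀ + B₁) + β • (A₀ * (B₀ + B₁) - A₁ * (B₀ - B₁))) -
          β • (s • 1 - bellOp β A₀ A₁ B₀ B₁)) := by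
  have e₀ (x : M) : A₀ * (A₀ * x) = x := by rw [← mul_assoc, hA₀, one_mul]
  simp only [bellOp, mul_add, add_mul, sub_mul, mul_sub, smul_mul_assoc, mul_smul_comm, smul_smul,
    mul_one, one_mul, mul_assoc, e₀, hA₀, smul_add, smul_sub]
  linear_combination (norm := module) hs • (β • A₀ + A₀ * B₀ + A₀ * B₁)

/-- Put `p = B₀ + B₁`, `m = B₀ - B₁`, `W = s - 2A₀p`. Multiplying `βA₁ - A₀m - A₁p` by `β + p`
leaves `A₁(β² - p²) - βA₀m - A₀pm`. Here `p²` is the scalar `s²/4` up to a multiple of `W`, and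
`A₀m` is a combination of `WA₀m` and `pm`. The leftovers `pm` and `A₀pm` are skew-adjoint in the
application, since `p` and `m` anticommute. -/
theorem alice_identity {β s : K} (hs : s ^ 2 = 8 + 2 * β ^ 2) {A₀ A₁ B₀ B₁ : M}
    (hA₀ : A₀ * A₀ = 1) (hB₀ : B₀ * B₀ = 1) (hB₁ : B₁ * B₁ = 1)
    (h₀₀ : Commute A₀ B₀) (h₀₁ : Commute A₀ B₁) (h₁₀ : Commute A₁ B₀) (h₁₁ : Commute A₁ B₁) :
    (2 * (4 - β ^ 2) * s) • A₁ =
      s • (A₁ * (s • 1 + (2 : K) • (A₀ * (B₀ + B₁))) * (s • 1 - (2 : K) • (A₀ * (B₀ + B₁)))) -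
      (4 * s) • ((β • 1 + (B₀ + B₁)) * (β • A₁ - A₀ * (B₀ - B₁) - A₁ * (B₀ + B₁))) -
      (4 * β) • ((s • 1 - (2 : K) • (A₀ * (B₀ + B₁))) * (A₀ * (B₀ - B₁))) -
      (8 * β) • ((B₀ + B₁) * (B₀ - B₁)) - (4 * s) • (A₀ * ((B₀ + B₁) * (B₀ - B₁))) := by
  have c₀₀ := h₀₀.eq.symm
  have c₀₁ := h₀₁.eq.symm
  have c₁₀ := h₁₀.eq.symm
  have c₁₁ := h₁₁.eq.symm
  have d₀₀ (x : M) : B₀ * (A₀ * x) = A₀ * (B₀ * x) := by rw [← mul_assoc, c₀₀, mul_assoc]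
  have d₀₁ (x : M) : B₁ * (A₀ * x) = A₀ * (B₁ * x) := by rw [← mul_assoc, c₀₁, mul_assoc]
  have d₁₀ (x : M) : B₀ * (A₁ * x) = A₁ * (B₀ * x) := by rw [← mul_assoc, c₁₀, mul_assoc]
  have d₁₁ (x : M) : B₁ * (A₁ * x) = A₁ * (B₁ * x) := by rw [← mul_assoc, c₁₁, mul_assoc]
  have e₀ (x : M) : A₀ * (A₀ * x) = x := by rw [← mul_assoc, hA₀, one_mul]
  simp only [mul_add, add_mul, sub_mul, mul_sub, smul_mul_assoc, mul_smul_comm, smul_smul,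
    mul_one, one_mul, mul_assoc, c₁₀, c₁₁, d₀₀, d₀₁, d₁₀, d₁₁, e₀, hA₀, hB₀, hB₁,
    smul_add, smul_sub]
  linear_combination (norm := module) -(s • hs • A₁)

end Algebra

/-! ### Near-optimal vectors for self-adjoint unitaries -/

section Projective

variable {H : Type*} [NormedAddCommGroup H] [InnerProductSpace ℂ H] [CompleteSpace H]

theorem norm_le_one_of_mul_self_eq_one {A : H →L[ℂ] H} (hA : IsSelfAdjoint A) (h : A * A = 1) :
    ‖A‖ ≤ 1 := by
  have h₁ := CStarRing.norm_star_mul_self (x := A)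
  rw [hA.star_eq, h] at h₁
  -- Only an inequality, since the space may be trivial.
  have h₂ : ‖(1 : H →L[ℂ] H)‖ ≤ 1 := ContinuousLinearMap.norm_id_le
  nlinarith [norm_nonneg A]

theorem norm_sq_apply_of_isSelfAdjoint {T : H →L[ℂ] H} (hT : IsSelfAdjoint T) (ψ : H) :
    ‖T ψ‖ ^ 2 = (⟪ψ, (T * T) ψ⟫_ℂ).re := by
  rw [mul_apply_eq_comp, ← ContinuousLinearMap.adjoint_inner_left,
    ← ContinuousLinearMap.star_eq_adjoint, hT.star_eq, ← inner_self_eq_norm_sq (𝕜 := ℂ)]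
  rfl

theorem re_inner_eq_zero_of_star_eq_neg {T : H →L[ℂ] H} (hT : star T = -T) (ψ : H) :
    (⟪ψ, T ψ⟫_ℂ).re = 0 := by
  have h : ⟪ψ, T ψ⟫_ℂ = -⟪T ψ, ψ⟫_ℂ := by
    rw [← ContinuousLinearMap.adjoint_inner_left, ← ContinuousLinearMap.star_eq_adjoint, hT]
    simp
  have h' := congrArg Complex.re h
  rw [Complex.neg_re, ← inner_conj_symm ψ, Complex.conj_re] at h'
  rw [← inner_conj_symm, Complex.conj_re]
  linarith

omit [CompleteSpace H] in
theorem abs_re_inner_mul_le (S T : H →L[ℂ] H) (ψ : H) :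
    |(⟪ψ, (S * T) ψ⟫_ℂ).re| ≤ ‖S‖ * ‖T ψ‖ * ‖ψ‖ := by
  refine (Complex.abs_re_le_norm _).trans ((norm_inner_le_norm _ _).trans ?_)
  rw [mul_comm]
  exact mul_le_mul_of_nonneg_right (S.le_opNorm _) (norm_nonneg _)

/-- The two sums of squares: the commuting operators saturate the bound up to an error that
controls three vectors. -/
theorem norms_le_of_bellOp {β s : ℝ} (hs : s ^ 2 = 8 + 2 * β ^ 2) {A₀ A₁ B₀ B₁ : H →L[ℂ] H}
    (sA₀ : IsSelfAdjoint A₀) (sA₁ : IsSelfAdjoint A₁)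
    (sB₀ : IsSelfAdjoint B₀) (sB₁ : IsSelfAdjoint B₁)
    (hA₀ : A₀ * A₀ = 1) (hA₁ : A₁ * A₁ = 1) (hB₀ : B₀ * B₀ = 1) (hB₁ : B₁ * B₁ = 1)
    (h₀₀ : Commute A₀ B₀) (h₀₁ : Commute A₀ B₁) (h₁₀ : Commute A₁ B₀) (h₁₁ : Commute A₁ B₁)
    (ψ : H) :
    ‖((s : ℂ) • 1 - bellOp (β : ℂ) A₀ A₁ B₀ B₁) ψ‖ ^ 2 +
      ‖((β : ℂ) • A₁ - A₀ * (B₀ - B₁) - A₁ * (B₀ + B₁)) ψ‖ ^ 2 =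
      2 * s * (s * ‖ψ‖ ^ 2 - (⟪ψ, bellOp (β : ℂ) A₀ A₁ B₀ B₁ ψ⟫_ℂ).re) ∧
    ‖((4 : ℂ) • A₀ - (s : ℂ) • (B₀ + B₁) + (β : ℂ) • (A₀ * (B₀ + B₁) - A₁ * (B₀ - B₁))) ψ‖ ^ 2 ≤
      8 * s * (s * ‖ψ‖ ^ 2 - (⟪ψ, bellOp (β : ℂ) A₀ A₁ B₀ B₁ ψ⟫_ℂ).re) := by
  have hs' : (s : ℂ) ^ 2 = 8 + 2 * (β : ℂ) ^ 2 := by exact_mod_cast hs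
  have sr (r : ℝ) : IsSelfAdjoint (r : ℂ) := Complex.conj_ofReal r
  have s4 : IsSelfAdjoint (4 : ℂ) := by simp
  have m₀₀ := (sA₀.commute_iff sB₀).mp h₀₀
  have m₀₁ := (sA₀.commute_iff sB₁).mp h₀₁
  have m₁₀ := (sA₁.commute_iff sB₀).mp h₁₀
  have m₁₁ := (sA₁.commute_iff sB₁).mp h₁₁
  have t₁ : IsSelfAdjoint (A₀ * (B₀ - B₁)) := by rw [mul_sub]; exact m₀₀.sub m₀₁
  have t₂ : IsSelfAdjoint (A₁ * (B₀ + B₁)) := by rw [mul_add]; exact m₁₀.add m₁₁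
  have t₃ : IsSelfAdjoint (A₀ * (B₀ + B₁)) := by rw [mul_add]; exact m₀₀.add m₀₁
  have t₄ : IsSelfAdjoint (A₁ * (B₀ - B₁)) := by rw [mul_sub]; exact m₁₀.sub m₁₁
  have tI : IsSelfAdjoint (bellOp (β : ℂ) A₀ A₁ B₀ B₁) :=
    (((((sr β).smul sA₀).add m₀₀).add m₀₁).add m₁₀).sub m₁₁
  have key (c : ℝ) : (⟪ψ, ((c : ℂ) • ((s : ℂ) • 1 - bellOp (β : ℂ) A₀ A₁ B₀ B₁)) ψ⟫_ℂ).re =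
      c * (s * ‖ψ‖ ^ 2 - (⟪ψ, bellOp (β : ℂ) A₀ A₁ B₀ B₁ ψ⟫_ℂ).re) := by
    simp only [smul_apply, sub_apply, inner_smul_right, inner_sub_right, Complex.re_ofReal_mul,
      Complex.sub_re, one_apply_eq_self]
    rw [← inner_self_eq_norm_sq (𝕜 := ℂ)]
    rfl
  have i₁ := congrArg (fun T : H →L[ℂ] H => (⟪ψ, T ψ⟫_ℂ).re)
    (bellOp_sos_fst hs' hA₀ hA₁ hB₀ hB₁ h₀₀ h₀₁ h₁₀ h₁₁)
  have i₂ := congrArg (fun T : H →L[ℂ] H => (⟪ψ, T ψ⟫_ℂ).re)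
    (bellOp_sos_snd hs' hA₀ hA₁ hB₀ hB₁ h₀₀ h₀₁ h₁₀ h₁₁)
  have k₁ := key (2 * s)
  have k₂ := key (8 * s)
  simp only [Complex.ofReal_mul, Complex.ofReal_ofNat] at k₁ k₂
  rw [k₁, add_apply, inner_add_right, Complex.add_re, ← norm_sq_apply_of_isSelfAdjoint,
    ← norm_sq_apply_of_isSelfAdjoint] at i₁
  · rw [k₂, add_apply, inner_add_right, Complex.add_re, ← norm_sq_apply_of_isSelfAdjoint,
      ← norm_sq_apply_of_isSelfAdjoint] at i₂
    · exact ⟨i₁, i₂ ▸ le_add_of_nonneg_right (sq_nonneg _)⟩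
    · exact ((s4.smul sA₁).sub ((sr s).smul (sB₀.sub sB₁))).add ((sr β).smul (t₁.sub t₂))
    · exact ((s4.smul sA₀).sub ((sr s).smul (sB₀.add sB₁))).add ((sr β).smul (t₃.sub t₄))
  · exact (((sr β).smul sA₁).sub t₁).sub t₂
  · exact ((sr s).smul (.one _)).sub tI

/-- The constant is `8 · 4`: the factor `2β + s A₀` has norm at most 8, and the remaining vector has
norm at most `2e + βe ≤ 4e`. -/
theorem norm_apply_one_sub_mul_le {β s : ℝ} (hβ₀ : 0 ≤ β) (hβ₂ : β < 2) (hs₀ : 0 ≤ s)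
    (hs : s ^ 2 = 8 + 2 * β ^ 2) {A₀ A₁ B₀ B₁ : H →L[ℂ] H} (sA₀ : IsSelfAdjoint A₀)
    (hA₀ : A₀ * A₀ = 1) {ψ : H} {e : ℝ}
    (hR : ‖((s : ℂ) • 1 - bellOp (β : ℂ) A₀ A₁ B₀ B₁) ψ‖ ≤ e)
    (hQ : ‖((4 : ℂ) • A₀ - (s : ℂ) • (B₀ + B₁) +
      (β : ℂ) • (A₀ * (B₀ + B₁) - A₁ * (B₀ - B₁))) ψ‖ ≤ 2 * e) :
    (4 - β ^ 2) * ‖((s : ℂ) • 1 - (2 : ℂ) • (A₀ * (B₀ + B₁))) ψ‖ ≤ 32 * e := by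
  have hs' : (s : ℂ) ^ 2 = 8 + 2 * (β : ℂ) ^ 2 := by exact_mod_cast hs
  have hs₄ : s ≤ 4 := by nlinarith
  have hg : 0 < 4 - β ^ 2 := by nlinarith
  have nr {r : ℝ} (hr : 0 ≤ r) : ‖(r : ℂ)‖ = r := by simp [abs_of_nonneg hr]
  have j := congrArg (fun T : H →L[ℂ] H => ‖T ψ‖)
    (one_sub_mul_identity hs' (A₁ := A₁) (B₀ := B₀) (B₁ := B₁) hA₀)
  have l : (4 : ℂ) - (β : ℂ) ^ 2 = ((4 - β ^ 2 : ℝ) : ℂ) := by push_cast; rfl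
  rw [l, smul_apply, norm_smul, nr hg.le, mul_apply_eq_comp] at j
  rw [j]
  have r₁ : ‖((2 * (β : ℂ)) • (1 : H →L[ℂ] H) + (s : ℂ) • A₀)‖ ≤ 8 := by
    refine (norm_add_le _ _).trans ?_
    rw [norm_smul, norm_smul, nr hs₀, norm_mul, nr hβ₀, RCLike.norm_ofNat]
    have b1 : ‖(1 : H →L[ℂ] H)‖ ≤ 1 := ContinuousLinearMap.norm_id_le
    have h₁ := mul_le_mul (show 2 * β ≤ 4 by linarith) b1 (norm_nonneg _) (by norm_num)
    have h₂ := mul_le_mul hs₄ (norm_le_one_of_mul_self_eq_one sA₀ hA₀) (norm_nonneg _)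
      (by norm_num)
    linarith
  refine (ContinuousLinearMap.le_opNorm _ _).trans ?_
  rw [show 32 * e = 8 * (4 * e) by ring]
  refine mul_le_mul r₁ ?_ (norm_nonneg _) (by norm_num)
  rw [sub_apply, smul_apply]
  refine (norm_sub_le _ _).trans ?_
  rw [norm_smul, nr hβ₀]
  have h₁ := mul_le_mul hβ₂.le hR (norm_nonneg _) (by norm_num)
  linarith

/-- Takes real parts of expectations in `alice_identity`: the two skew-adjoint terms drop out, and
each remaining term contains an operator that is small on `ψ`. -/
theorem abs_re_inner_le_of_norms {β s : ℝ} (hβ₀ : 0 ≤ β) (hβ₂ : β < 2) (hs₀ : 2 ≤ s) (hs₄ : s ≤ 4)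
    (hsβ : 2 * β ≤ s)
    (hs : s ^ 2 = 8 + 2 * β ^ 2) {A₀ A₁ B₀ B₁ : H →L[ℂ] H}
    (sA₀ : IsSelfAdjoint A₀) (sA₁ : IsSelfAdjoint A₁)
    (sB₀ : IsSelfAdjoint B₀) (sB₁ : IsSelfAdjoint B₁)
    (hA₀ : A₀ * A₀ = 1) (hA₁ : A₁ * A₁ = 1) (hB₀ : B₀ * B₀ = 1) (hB₁ : B₁ * B₁ = 1)
    (h₀₀ : Commute A₀ B₀) (h₀₁ : Commute A₀ B₁) (h₁₀ : Commute A₁ B₀) (h₁₁ : Commute A₁ B₁)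
    {ψ : H} {e w : ℝ}
    (hR : ‖((β : ℂ) • A₁ - A₀ * (B₀ - B₁) - A₁ * (B₀ + B₁)) ψ‖ ≤ e)
    (hW : ‖((s : ℂ) • 1 - (2 : ℂ) • (A₀ * (B₀ + B₁))) ψ‖ ≤ w) :
    (4 - β ^ 2) * |(⟪ψ, A₁ ψ⟫_ℂ).re| ≤ (8 * e + 6 * w) * ‖ψ‖ := by
  have hs' : (s : ℂ) ^ 2 = 8 + 2 * (β : ℂ) ^ 2 := by exact_mod_cast hs
  have hg : 0 < 4 - β ^ 2 := by nlinarith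
  have he : 0 ≤ e := (norm_nonneg _).trans hR
  have hw : 0 ≤ w := (norm_nonneg _).trans hW
  have nr {r : ℝ} (hr : 0 ≤ r) : ‖(r : ℂ)‖ = r := by simp [abs_of_nonneg hr]
  have bA₀ := norm_le_one_of_mul_self_eq_one sA₀ hA₀
  have bA₁ := norm_le_one_of_mul_self_eq_one sA₁ hA₁
  have bB₀ := norm_le_one_of_mul_self_eq_one sB₀ hB₀
  have bB₁ := norm_le_one_of_mul_self_eq_one sB₁ hB₁
  have b1 : ‖(1 : H →L[ℂ] H)‖ ≤ 1 := ContinuousLinearMap.norm_id_le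
  have bp : ‖B₀ + B₁‖ ≤ 2 := (norm_add_le _ _).trans (by linarith)
  have bm : ‖B₀ - B₁‖ ≤ 2 := (norm_sub_le _ _).trans (by linarith)
  have bAp : ‖A₀ * (B₀ + B₁)‖ ≤ 2 := (norm_mul_le _ _).trans
    (by have := mul_le_mul bA₀ bp (norm_nonneg _) zero_le_one; linarith)
  have bAm : ‖A₀ * (B₀ - B₁)‖ ≤ 2 := (norm_mul_le _ _).trans
    (by have := mul_le_mul bA₀ bm (norm_nonneg _) zero_le_one; linarith)
  have sp : star (B₀ + B₁) = B₀ + B₁ := (sB₀.add sB₁).star_eq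
  have sm : star (B₀ - B₁) = B₀ - B₁ := (sB₀.sub sB₁).star_eq
  have hpm : (B₀ - B₁) * (B₀ + B₁) = -((B₀ + B₁) * (B₀ - B₁)) := by
    simp only [mul_add, add_mul, sub_mul, mul_sub, hB₀, hB₁]
    abel
  have cp : Commute A₀ (B₀ + B₁) := h₀₀.add_right h₀₁
  have cm : Commute A₀ (B₀ - B₁) := h₀₀.sub_right h₀₁
  have z₁ := re_inner_eq_zero_of_star_eq_neg (T := (B₀ + B₁) * (B₀ - B₁))
    (by rw [star_mul, sp, sm, hpm]) ψ
  have z₂ := re_inner_eq_zero_of_star_eq_neg (T := A₀ * ((B₀ + B₁) * (B₀ - B₁)))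
    (by rw [star_mul, star_mul, sp, sm, hpm, sA₀.star_eq, neg_mul, (cp.mul_right cm).eq]) ψ
  have sW : star ((s : ℂ) • 1 - (2 : ℂ) • (A₀ * (B₀ + B₁))) =
      (s : ℂ) • 1 - (2 : ℂ) • (A₀ * (B₀ + B₁)) := by
    rw [star_sub, star_smul, star_smul, star_mul, sp, sA₀.star_eq, cp.eq, star_one]
    simp
  have j := congrArg (fun T : H →L[ℂ] H => (⟪ψ, T ψ⟫_ℂ).re)
    (alice_identity hs' hA₀ hB₀ hB₁ h₀₀ h₀₁ h₁₀ h₁₁)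
  have l₁ : 2 * ((4 : ℂ) - (β : ℂ) ^ 2) * s = ((2 * (4 - β ^ 2) * s : ℝ) : ℂ) := by push_cast; rfl
  have l₂ : 4 * (s : ℂ) = ((4 * s : ℝ) : ℂ) := by push_cast; rfl
  have l₃ : 4 * (β : ℂ) = ((4 * β : ℝ) : ℂ) := by push_cast; rfl
  have l₄ : 8 * (β : ℂ) = ((8 * β : ℝ) : ℂ) := by push_cast; rfl
  rw [l₁, l₂, l₃, l₄] at j
  have k₁ := abs_re_inner_mul_le (A₁ * ((s : ℂ) • 1 + (2 : ℂ) • (A₀ * (B₀ + B₁))))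
    ((s : ℂ) • 1 - (2 : ℂ) • (A₀ * (B₀ + B₁))) ψ
  have k₂ := abs_re_inner_mul_le ((β : ℂ) • 1 + (B₀ + B₁))
    ((β : ℂ) • A₁ - A₀ * (B₀ - B₁) - A₁ * (B₀ + B₁)) ψ
  -- The small factor stands on the left here, so self-adjointness is used to move it onto the other
  -- `ψ`.
  have k₃ : |(⟪ψ, (((s : ℂ) • 1 - (2 : ℂ) • (A₀ * (B₀ + B₁))) * (A₀ * (B₀ - B₁))) ψ⟫_ℂ).re| ≤
      w * (2 * ‖ψ‖) := by
    rw [mul_apply_eq_comp, ← ContinuousLinearMap.adjoint_inner_left,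
      ← ContinuousLinearMap.star_eq_adjoint, sW]
    refine (Complex.abs_re_le_norm _).trans ((norm_inner_le_norm _ _).trans ?_)
    refine mul_le_mul hW ((ContinuousLinearMap.le_opNorm _ _).trans ?_) (norm_nonneg _) hw
    exact mul_le_mul_of_nonneg_right bAm (norm_nonneg _)
  have n₁ : ‖A₁ * ((s : ℂ) • 1 + (2 : ℂ) • (A₀ * (B₀ + B₁)))‖ ≤ 8 := by
    have : ‖(s : ℂ) • (1 : H →L[ℂ] H) + (2 : ℂ) • (A₀ * (B₀ + B₁))‖ ≤ 8 := by
      refine (norm_add_le _ _).trans ?_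
      rw [norm_smul, norm_smul, nr (by linarith), RCLike.norm_ofNat]
      have := mul_le_mul hs₄ b1 (norm_nonneg _) (by norm_num)
      linarith
    refine (norm_mul_le _ _).trans ?_
    have := mul_le_mul bA₁ this (norm_nonneg _) zero_le_one
    linarith
  have n₂ : ‖(β : ℂ) • (1 : H →L[ℂ] H) + (B₀ + B₁)‖ ≤ 4 := by
    refine (norm_add_le _ _).trans ?_
    rw [norm_smul, nr hβ₀]
    have := mul_le_mul hβ₂.le b1 (norm_nonneg _) (by norm_num)
    linarith
  replace k₁ := k₁.trans (mul_le_mul_of_nonneg_right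
    (mul_le_mul n₁ hW (norm_nonneg _) (by norm_num)) (norm_nonneg _))
  replace k₂ := k₂.trans (mul_le_mul_of_nonneg_right
    (mul_le_mul n₂ hR (norm_nonneg _) (by norm_num)) (norm_nonneg _))
  simp only [smul_apply, sub_apply, inner_smul_right, inner_sub_right, Complex.re_ofReal_mul,
    Complex.sub_re, z₁, z₂, mul_zero, sub_zero] at j
  have hj := congrArg abs j
  rw [abs_mul, abs_of_nonneg (show 0 ≤ 2 * (4 - β ^ 2) * s by nlinarith)] at hj
  have h₁ := mul_le_mul_of_nonneg_left k₁ (show 0 ≤ s by linarith)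
  have h₂ := mul_le_mul_of_nonneg_left k₂ (show 0 ≤ 4 * s by linarith)
  have h₃ := mul_le_mul_of_nonneg_left k₃ (show 0 ≤ 4 * β by linarith)
  -- The term with coefficient `4β` is bounded through `2β ≤ s`, so that `2s` can be cancelled from
  -- the whole estimate.
  have h₄ := mul_le_mul_of_nonneg_right hsβ
    (show 0 ≤ w * (2 * ‖ψ‖) from mul_nonneg hw (by positivity))
  have hb := hj.le.trans ((abs_sub _ _).trans (add_le_add_left (abs_sub _ _) _))
  rw [abs_mul s, abs_mul (4 * s), abs_mul (4 * β), abs_of_nonneg (show 0 ≤ s by linarith),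
    abs_of_nonneg (show 0 ≤ 4 * s by linarith), abs_of_nonneg (show 0 ≤ 4 * β by linarith)] at hb
  refine le_of_mul_le_mul_left ?_ (show 0 < 2 * s by linarith)
  linarith

theorem abs_re_inner_le_of_mul_self_eq_one {β s : ℝ} (hβ₀ : 0 ≤ β) (hβ₂ : β < 2) (hs₀ : 0 ≤ s)
    (hs : s ^ 2 = 8 + 2 * β ^ 2) {A₀ A₁ B₀ B₁ : H →L[ℂ] H}
    (sA₀ : IsSelfAdjoint A₀) (sA₁ : IsSelfAdjoint A₁)
    (sB₀ : IsSelfAdjoint B₀) (sB₁ : IsSelfAdjoint B₁)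
    (hA₀ : A₀ * A₀ = 1) (hA₁ : A₁ * A₁ = 1) (hB₀ : B₀ * B₀ = 1) (hB₁ : B₁ * B₁ = 1)
    (h₀₀ : Commute A₀ B₀) (h₀₁ : Commute A₀ B₁) (h₁₀ : Commute A₁ B₀) (h₁₁ : Commute A₁ B₁)
    (ψ : H) :
    0 ≤ s * ‖ψ‖ ^ 2 - (⟪ψ, bellOp (β : ℂ) A₀ A₁ B₀ B₁ ψ⟫_ℂ).re ∧
    (4 - β ^ 2) ^ 2 * |(⟪ψ, A₁ ψ⟫_ℂ).re| ≤
      864 * ‖ψ‖ * √(s * ‖ψ‖ ^ 2 - (⟪ψ, bellOp (β : ℂ) A₀ A₁ B₀ B₁ ψ⟫_ℂ).re) := by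
  have hs₂ : 2 < s := by nlinarith [sq_nonneg β]
  have hs₄ : s ≤ 4 := by nlinarith
  have hsβ : 2 * β ≤ s := by nlinarith
  obtain ⟨n₁, n₂⟩ := norms_le_of_bellOp hs sA₀ sA₁ sB₀ sB₁ hA₀ hA₁ hB₀ hB₁ h₀₀ h₀₁ h₁₀ h₁₁ ψ
  set δ := s * ‖ψ‖ ^ 2 - (⟪ψ, bellOp (β : ℂ) A₀ A₁ B₀ B₁ ψ⟫_ℂ).re with hδ
  have hδ₀ : 0 ≤ δ := by
    have := add_nonneg (sq_nonneg ‖((s : ℂ) • 1 - bellOp (β : ℂ) A₀ A₁ B₀ B₁) ψ‖)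
      (sq_nonneg ‖((β : ℂ) • A₁ - A₀ * (B₀ - B₁) - A₁ * (B₀ + B₁)) ψ‖)
    rw [n₁] at this
    exact (mul_nonneg_iff_of_pos_left (by linarith)).mp this
  refine ⟨hδ₀, ?_⟩
  set R := (s : ℂ) • 1 - bellOp (β : ℂ) A₀ A₁ B₀ B₁
  set R' := (β : ℂ) • A₁ - A₀ * (B₀ - B₁) - A₁ * (B₀ + B₁)
  set Q := (4 : ℂ) • A₀ - (s : ℂ) • (B₀ + B₁) + (β : ℂ) • (A₀ * (B₀ + B₁) - A₁ * (B₀ - B₁))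
  -- With `s ≤ 4` the squared norms are at most `8δ ≤ e²` for the first decomposition and `32δ ≤
  -- (2e)²` for the second, which explains the 3.
  set e := 3 * √δ with he
  have he₀ : 0 ≤ e := by positivity
  have he₂ : e ^ 2 = 9 * δ := by rw [he, mul_pow, Real.sq_sqrt hδ₀]; norm_num
  have bR : ‖R ψ‖ ≤ e := abs_le_of_sq_le_sq' (by nlinarith [sq_nonneg ‖R' ψ‖]) he₀ |>.2
  have bR' : ‖R' ψ‖ ≤ e := abs_le_of_sq_le_sq' (by nlinarith [sq_nonneg ‖R ψ‖]) he₀ |>.2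
  have bQ : ‖Q ψ‖ ≤ 2 * e := abs_le_of_sq_le_sq' (by nlinarith) (by positivity) |>.2
  have hg : 0 < 4 - β ^ 2 := by nlinarith
  have bW := norm_apply_one_sub_mul_le hβ₀ hβ₂ hs₀ hs sA₀ hA₀ bR bQ
  have h := abs_re_inner_le_of_norms hβ₀ hβ₂ hs₂.le hs₄ hsβ hs sA₀ sA₁ sB₀ sB₁ hA₀ hA₁ hB₀ hB₁
    h₀₀ h₀₁ h₁₀ h₁₁ bR' le_rfl
  have h₁ := mul_le_mul_of_nonneg_left h hg.le
  have h₂ := mul_le_mul_of_nonneg_right bW (norm_nonneg ψ)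
  have h₃ : (4 - β ^ 2) * (e * ‖ψ‖) ≤ 4 * (e * ‖ψ‖) :=
    mul_le_mul_of_nonneg_right (by nlinarith) (by positivity)
  have h₄ : 0 ≤ e * ‖ψ‖ := by positivity
  rw [sq, mul_assoc, show 864 * ‖ψ‖ * √δ = 288 * (e * ‖ψ‖) by rw [he]; ring]
  linarith

end Projective

/-! ### Unitary dilation of contractions to the doubled space -/

section Dilation

variable {H : Type*} [NormedAddCommGroup H] [InnerProductSpace ℂ H]

/-- The operator on `H × H` given by a two-by-two block matrix. -/
def blockOp (a b c d : H →L[ℂ] H) : WithLp 2 (H × H) →L[ℂ] WithLp 2 (H × H) :=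
  (WithLp.prodContinuousLinearEquiv 2 ℂ H H).symm.toContinuousLinearMap ∘L
    (((a.coprod b).prod (c.coprod d)) ∘L
      (WithLp.prodContinuousLinearEquiv 2 ℂ H H).toContinuousLinearMap)

theorem blockOp_apply (a b c d : H →L[ℂ] H) (x : WithLp 2 (H × H)) :
    blockOp a b c d x = WithLp.toLp 2 (a x.fst + b x.snd, c x.fst + d x.snd) := rfl

theorem blockOp_mul (a b c d a' b' c' d' : H →L[ℂ] H) :
    blockOp a b c d * blockOp a' b' c' d' =
      blockOp (a * a' + b * c') (a * b' + b * d') (c * a' + d * c') (c * b' + d * d') := by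
  refine ContinuousLinearMap.ext fun x => ?_
  change WithLp.toLp 2 (a (a' x.fst + b' x.snd) + b (c' x.fst + d' x.snd),
    c (a' x.fst + b' x.snd) + d (c' x.fst + d' x.snd)) = _
  simp only [mul_apply_eq_comp, blockOp_apply, add_apply, map_add]
  congr 2 <;> abel

theorem blockOp_one : blockOp (1 : H →L[ℂ] H) 0 0 1 = 1 := by
  refine ContinuousLinearMap.ext fun x => ?_
  simp only [blockOp_apply, one_apply_eq_self, zero_apply, add_zero, zero_add]
  rfl

variable [CompleteSpace H]

theorem isSelfAdjoint_blockOp {a b d : H →L[ℂ] H} (ha : IsSelfAdjoint a) (hb : IsSelfAdjoint b)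
    (hd : IsSelfAdjoint d) : IsSelfAdjoint (blockOp a b b d) := by
  rw [ContinuousLinearMap.isSelfAdjoint_iff_isSymmetric] at *
  intro x y
  have h₁ := ha x.fst y.fst
  have h₂ := hb x.fst y.snd
  have h₃ := hb x.snd y.fst
  have h₄ := hd x.snd y.snd
  simp only [ContinuousLinearMap.coe_coe] at h₁ h₂ h₃ h₄
  simp only [ContinuousLinearMap.coe_coe, blockOp_apply, WithLp.prod_inner_apply, inner_add_left,
    inner_add_right]
  change ⟪a x.fst, y.fst⟫_ℂ + ⟪b x.snd, y.fst⟫_ℂ + (⟪b x.fst, y.snd⟫_ℂ + ⟪d x.snd, y.snd⟫_ℂ) =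
    ⟪x.fst, a y.fst⟫_ℂ + ⟪x.fst, b y.snd⟫_ℂ + (⟪x.snd, b y.fst⟫_ℂ + ⟪x.snd, d y.snd⟫_ℂ)
  linear_combination h₁ + h₂ + h₃ + h₄

/-- A self-adjoint contraction. -/
structure IsContraction (A : H →L[ℂ] H) : Prop where
  isSelfAdjoint : IsSelfAdjoint A
  norm_le_one : ‖A‖ ≤ 1

/-- A self-adjoint unitary. -/
structure IsReflection (A : H →L[ℂ] H) : Prop where
  isSelfAdjoint : IsSelfAdjoint A
  mul_self : A * A = 1

/-- The defect operator `√(1 - A²)`. -/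
def defect (A : H →L[ℂ] H) : H →L[ℂ] H := CFC.sqrt (1 - A * A)

/-- The unitary dilation of a self-adjoint contraction. -/
def dilation (A : H →L[ℂ] H) : WithLp 2 (H × H) →L[ℂ] WithLp 2 (H × H) :=
  blockOp A (defect A) (defect A) (-A)

/-- The operator acting as `A` in both coordinates. -/
def diagonal (A : H →L[ℂ] H) : WithLp 2 (H × H) →L[ℂ] WithLp 2 (H × H) :=
  blockOp A 0 0 A

/-- The square root lies in the functional calculus of `1 - A * A`, which commutes with `T`. -/
theorem commute_defect {A T : H →L[ℂ] H} (h : Commute A T) : Commute (defect A) T := by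
  have : Commute (1 - A * A) T := (Commute.one_left T).sub_left (h.mul_left h)
  exact this.cfcₙ_nnreal _

theorem IsContraction.defect_mul_self {A : H →L[ℂ] H} (hA : IsContraction A) :
    defect A * defect A = 1 - A * A := by
  refine CFC.sqrt_mul_sqrt_self _ (sub_nonneg.mpr ?_)
  have h := CStarAlgebra.star_mul_le_algebraMap_norm_sq (a := A)
  rw [hA.isSelfAdjoint.star_eq] at h
  refine h.trans ?_
  rw [← map_one (algebraMap ℝ (H →L[ℂ] H))]
  exact algebraMap_mono _ (pow_le_one₀ (norm_nonneg _) hA.norm_le_one)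

theorem IsContraction.isReflection_dilation {A : H →L[ℂ] H} (hA : IsContraction A) :
    IsReflection (dilation A) where
  isSelfAdjoint := isSelfAdjoint_blockOp hA.isSelfAdjoint (CFC.sqrt_nonneg _).isSelfAdjoint
    hA.isSelfAdjoint.neg
  mul_self := by
    rw [dilation, blockOp_mul, ← blockOp_one, hA.defect_mul_self,
      (commute_defect (Commute.refl A)).eq]
    congr 1 <;> simp [(commute_defect (Commute.refl A)).eq]

theorem IsReflection.diagonal {A : H →L[ℂ] H} (hA : IsReflection A) :
    IsReflection (diagonal A) where
  isSelfAdjoint := isSelfAdjoint_blockOp hA.isSelfAdjoint (.zero _) hA.isSelfAdjoint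
  mul_self := by
    rw [TiltedCHSH.diagonal, blockOp_mul, ← blockOp_one, hA.mul_self]
    congr 1 <;> simp

theorem IsContraction.diagonal {A : H →L[ℂ] H} (hA : IsContraction A) :
    IsContraction (diagonal A) where
  isSelfAdjoint := isSelfAdjoint_blockOp hA.isSelfAdjoint (.zero _) hA.isSelfAdjoint
  norm_le_one := by
    refine ContinuousLinearMap.opNorm_le_bound _ zero_le_one fun x => ?_
    rw [one_mul, ← sq_le_sq₀ (norm_nonneg _) (norm_nonneg _), WithLp.prod_norm_sq_eq_of_L2,
      WithLp.prod_norm_sq_eq_of_L2]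
    have h (y : H) : ‖A y‖ ^ 2 ≤ ‖y‖ ^ 2 :=
      pow_le_pow_left₀ (norm_nonneg _) ((A.le_of_opNorm_le hA.norm_le_one y).trans_eq
        (one_mul _)) 2
    simpa [TiltedCHSH.diagonal, blockOp_apply] using add_le_add (h x.fst) (h x.snd)

omit [CompleteSpace H] in
theorem commute_diagonal {A T : H →L[ℂ] H} (h : Commute A T) :
    Commute (diagonal A) (diagonal T) := by
  rw [Commute, SemiconjBy, diagonal, diagonal, blockOp_mul, blockOp_mul, h.eq]
  congr 1 <;> simp

theorem commute_dilation_diagonal {A T : H →L[ℂ] H} (h : Commute A T) :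
    Commute (dilation A) (diagonal T) := by
  rw [Commute, SemiconjBy, diagonal, dilation, blockOp_mul, blockOp_mul]
  simp [h.eq, (commute_defect h).eq]

/-- The bound on the tilted CHSH operator with an additional bias of `A₁`. -/
def BiasedBound (β s c t : ℝ) (A₀ A₁ B₀ B₁ : H →L[ℂ] H) : Prop :=
  ∀ ψ : H, (⟪ψ, bellOp (β : ℂ) A₀ A₁ B₀ B₁ ψ⟫_ℂ).re + t * (⟪ψ, A₁ ψ⟫_ℂ).re ≤
    (s + c * t ^ 2) * ‖ψ‖ ^ 2

-- Evaluate at `(ψ, 0)`. Compression to the first coordinate is linear, and it respects the products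
-- in `bellOp` because their corner corrections are the off-diagonal products assumed to vanish.
omit [CompleteSpace H] in
theorem BiasedBound.compress {β s c t : ℝ} {A₀ A₁ B₀ B₁ a₀ a₁ b₀ b₁ a₀' a₁' b₀' b₁' : H →L[ℂ] H}
    (h : BiasedBound β s c t (blockOp A₀ a₀ a₀ a₀') (blockOp A₁ a₁ a₁ a₁') (blockOp B₀ b₀ b₀ b₀')
      (blockOp B₁ b₁ b₁ b₁'))
    (h₀₀ : a₀ * b₀ = 0) (h₀₁ : a₀ * b₁ = 0) (h₁₀ : a₁ * b₀ = 0) (h₁₁ : a₁ * b₁ = 0) :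
    BiasedBound β s c t A₀ A₁ B₀ B₁ := by
  intro ψ
  have e {S T : H →L[ℂ] H} (hST : S * T = 0) : S (T ψ) = 0 := by
    rw [← mul_apply_eq_comp, hST, zero_apply]
  have := h (WithLp.toLp 2 (ψ, 0))
  simpa [bellOp, blockOp_apply, e h₀₀, e h₀₁, e h₁₀, e h₁₁] using this

end Dilation

/-! ### The biased bound for unitaries and for contractions -/

section Bound

/-- The bound on the tilted CHSH operator with bias, for commuting self-adjoint unitaries. -/
theorem biasedBound_of_isReflection {β s : ℝ} (hβ₀ : 0 ≤ β) (hβ₂ : β < 2) (hs₀ : 0 ≤ s)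
    (hs : s ^ 2 = 8 + 2 * β ^ 2) (t : ℝ) {H : Type*} [NormedAddCommGroup H]
    [InnerProductSpace ℂ H] [CompleteSpace H] {A₀ A₁ B₀ B₁ : H →L[ℂ] H}
    (hA₀ : IsReflection A₀) (hA₁ : IsReflection A₁) (hB₀ : IsReflection B₀) (hB₁ : IsReflection B₁)
    (h₀₀ : Commute A₀ B₀) (h₀₁ : Commute A₀ B₁) (h₁₀ : Commute A₁ B₀) (h₁₁ : Commute A₁ B₁) :
    BiasedBound β s ((432 / (4 - β ^ 2) ^ 2) ^ 2) t A₀ A₁ B₀ B₁ := by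
  intro ψ
  obtain ⟨h₁, h₂⟩ := abs_re_inner_le_of_mul_self_eq_one hβ₀ hβ₂ hs₀ hs hA₀.1 hA₁.1 hB₀.1 hB₁.1
    hA₀.2 hA₁.2 hB₀.2 hB₁.2 h₀₀ h₀₁ h₁₀ h₁₁ ψ
  set δ := s * ‖ψ‖ ^ 2 - (⟪ψ, bellOp (β : ℂ) A₀ A₁ B₀ B₁ ψ⟫_ℂ).re with hδ
  have hg : 0 < (4 - β ^ 2) ^ 2 := by
    have : 0 < 4 - β ^ 2 := by nlinarith
    positivity
  have h₃ : |(⟪ψ, A₁ ψ⟫_ℂ).re| ≤ 2 * (432 / (4 - β ^ 2) ^ 2) * ‖ψ‖ * √δ := by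
    rw [mul_comm, ← le_div_iff₀ hg] at h₂
    refine h₂.trans_eq ?_
    ring
  have h₄ : t * (⟪ψ, A₁ ψ⟫_ℂ).re ≤ |t| * (2 * (432 / (4 - β ^ 2) ^ 2) * ‖ψ‖ * √δ) :=
    (le_abs_self _).trans ((abs_mul _ _).trans_le (mul_le_mul_of_nonneg_left h₃ (abs_nonneg _)))
  -- Arithmetic-geometric mean inequality: `2c|t|‖ψ‖√δ ≤ δ + c²t²‖ψ‖²`, and `δ` absorbs the gap.
  have h₅ := sq_nonneg (√δ - 432 / (4 - β ^ 2) ^ 2 * |t| * ‖ψ‖)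
  rw [sub_sq, Real.sq_sqrt h₁, mul_pow, mul_pow, sq_abs] at h₅
  linarith

/-- The bound on the tilted CHSH operator with bias, for commuting self-adjoint contractions. -/
theorem biasedBound_of_isContraction {β s : ℝ} (hβ₀ : 0 ≤ β) (hβ₂ : β < 2) (hs₀ : 0 ≤ s)
    (hs : s ^ 2 = 8 + 2 * β ^ 2) (t : ℝ) {H : Type*} [NormedAddCommGroup H]
    [InnerProductSpace ℂ H] [CompleteSpace H] {A₀ A₁ B₀ B₁ : H →L[ℂ] H}
    (hA₀ : IsContraction A₀) (hA₁ : IsContraction A₁)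
    (hB₀ : IsContraction B₀) (hB₁ : IsContraction B₁)
    (h₀₀ : Commute A₀ B₀) (h₀₁ : Commute A₀ B₁) (h₁₀ : Commute A₁ B₀) (h₁₁ : Commute A₁ B₁) :
    BiasedBound β s ((432 / (4 - β ^ 2) ^ 2) ^ 2) t A₀ A₁ B₀ B₁ := by
  -- Dilate one operator at a time and extend the other three diagonally: then each product of
  -- off-diagonal blocks has a zero factor, and the commutation relations persist.
  refine BiasedBound.compress (a₀ := defect A₀) (a₁ := 0) (b₀ := 0) (b₁ := 0) (a₀' := -A₀)
    (a₁' := A₁) (b₀' := B₀) (b₁' := B₁) ?_ (mul_zero _) (mul_zero _) (mul_zero _) (mul_zero _)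
  replace h₀₀ := commute_dilation_diagonal h₀₀
  replace h₀₁ := commute_dilation_diagonal h₀₁
  replace h₁₀ := commute_diagonal h₁₀
  replace h₁₁ := commute_diagonal h₁₁
  replace hA₀ := hA₀.isReflection_dilation
  replace hA₁ := hA₁.diagonal
  replace hB₀ := hB₀.diagonal
  replace hB₁ := hB₁.diagonal
  change BiasedBound _ _ _ _ (dilation A₀) (diagonal A₁) (diagonal B₀) (diagonal B₁)
  -- Forgetting the block form makes the doubled space the new ambient Hilbert space for the next
  -- dilation.
  generalize dilation A₀ = A₀, diagonal A₁ = A₁, diagonal B₀ = B₀, diagonal B₁ = B₁ at *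
  refine BiasedBound.compress (a₀ := 0) (a₁ := defect A₁) (b₀ := 0) (b₁ := 0) (a₀' := A₀)
    (a₁' := -A₁) (b₀' := B₀) (b₁' := B₁) ?_ (mul_zero _) (mul_zero _) (mul_zero _) (mul_zero _)
  replace h₀₀ := commute_diagonal h₀₀
  replace h₀₁ := commute_diagonal h₀₁
  replace h₁₀ := commute_dilation_diagonal h₁₀
  replace h₁₁ := commute_dilation_diagonal h₁₁
  replace hA₀ := hA₀.diagonal
  replace hA₁ := hA₁.isReflection_dilation
  replace hB₀ := hB₀.diagonal
  replace hB₁ := hB₁.diagonal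
  change BiasedBound _ _ _ _ (diagonal A₀) (dilation A₁) (diagonal B₀) (diagonal B₁)
  generalize diagonal A₀ = A₀, dilation A₁ = A₁, diagonal B₀ = B₀, diagonal B₁ = B₁ at *
  refine BiasedBound.compress (a₀ := 0) (a₁ := 0) (b₀ := defect B₀) (b₁ := 0) (a₀' := A₀)
    (a₁' := A₁) (b₀' := -B₀) (b₁' := B₁) ?_ (zero_mul _) (zero_mul _) (zero_mul _) (zero_mul _)
  replace h₀₀ := (commute_dilation_diagonal h₀₀.symm).symm
  replace h₀₁ := commute_diagonal h₀₁
  replace h₁₀ := (commute_dilation_diagonal h₁₀.symm).symm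
  replace h₁₁ := commute_diagonal h₁₁
  replace hA₀ := hA₀.diagonal
  replace hA₁ := hA₁.diagonal
  replace hB₀ := hB₀.isReflection_dilation
  replace hB₁ := hB₁.diagonal
  change BiasedBound _ _ _ _ (diagonal A₀) (diagonal A₁) (dilation B₀) (diagonal B₁)
  generalize diagonal A₀ = A₀, diagonal A₁ = A₁, dilation B₀ = B₀, diagonal B₁ = B₁ at *
  exact BiasedBound.compress (a₀ := 0) (a₁ := 0) (b₀ := 0) (b₁ := defect B₁) (a₀' := A₀)
    (a₁' := A₁) (b₀' := B₀) (b₁' := -B₁) (biasedBound_of_isReflection hβ₀ hβ₂ hs₀ hs t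
      hA₀.diagonal hA₁.diagonal hB₀.diagonal hB₁.isReflection_dilation
      (commute_diagonal h₀₀) (commute_dilation_diagonal h₀₁.symm).symm
      (commute_diagonal h₁₀) (commute_dilation_diagonal h₁₁.symm).symm)
    (zero_mul _) (zero_mul _) (zero_mul _) (zero_mul _)

end Bound

/-! ### Calculus of operators on Hilbert space tensor products -/

section TensorOp

variable {H K : Type*} [NormedAddCommGroup H] [InnerProductSpace ℂ H] [CompleteSpace H]
  [NormedAddCommGroup K] [InnerProductSpace ℂ K] [CompleteSpace K]

theorem tensorOp_coe (S : H →L[ℂ] H) (T : K →L[ℂ] K) (x : H ⊗[ℂ] K) :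
    tensorOp S T (x : HTensor H K) =
      ((TensorProduct.map (S : H →ₗ[ℂ] H) (T : K →ₗ[ℂ] K) x : H ⊗[ℂ] K) : HTensor H K) :=
  ContinuousLinearMap.completion_apply_coe _ _

theorem tensorOp_tmul (S : H →L[ℂ] H) (T : K →L[ℂ] K) (x : H) (y : K) :
    tensorOp S T ((x ⊗ₜ[ℂ] y : H ⊗[ℂ] K) : HTensor H K) =
      ((S x ⊗ₜ[ℂ] T y : H ⊗[ℂ] K) : HTensor H K) := by
  rw [tensorOp_coe, TensorProduct.map_tmul]
  rfl

omit [CompleteSpace H] [CompleteSpace K] in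
theorem htensor_ext {F : Type*} [NormedAddCommGroup F] [NormedSpace ℂ F]
    {f g : HTensor H K →L[ℂ] F}
    (h : ∀ x y, f ((x ⊗ₜ[ℂ] y : H ⊗[ℂ] K) : HTensor H K) =
      g ((x ⊗ₜ[ℂ] y : H ⊗[ℂ] K) : HTensor H K)) : f = g := by
  refine ContinuousLinearMap.ext fun z => ?_
  induction z using UniformSpace.Completion.induction_on with
  | hp => exact isClosed_eq f.continuous g.continuous
  | ih z =>
    induction z using TensorProduct.induction_on with
    | zero => simpa only [TensorProduct.zero_tmul] using h 0 0
    | tmul x y => exact h x y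
    | add x y hx hy => rw [UniformSpace.Completion.coe_add, map_add, map_add, hx, hy]

theorem tensorOp_mul (S S' : H →L[ℂ] H) (T T' : K →L[ℂ] K) :
    tensorOp S T * tensorOp S' T' = tensorOp (S * S') (T * T') :=
  htensor_ext fun x y => by simp only [mul_apply_eq_comp, tensorOp_tmul]

theorem tensorOp_one : tensorOp (1 : H →L[ℂ] H) (1 : K →L[ℂ] K) = 1 :=
  htensor_ext fun x y => by simp only [tensorOp_tmul, one_apply_eq_self]

theorem tensorOp_add_left (S S' : H →L[ℂ] H) (T : K →L[ℂ] K) :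
    tensorOp (S + S') T = tensorOp S T + tensorOp S' T :=
  htensor_ext fun x y => by
    simp only [add_apply, tensorOp_tmul, TensorProduct.add_tmul, UniformSpace.Completion.coe_add]

theorem tensorOp_add_right (S : H →L[ℂ] H) (T T' : K →L[ℂ] K) :
    tensorOp S (T + T') = tensorOp S T + tensorOp S T' :=
  htensor_ext fun x y => by
    simp only [add_apply, tensorOp_tmul, TensorProduct.tmul_add, UniformSpace.Completion.coe_add]

theorem tensorOp_smul_left (c : ℂ) (S : H →L[ℂ] H) (T : K →L[ℂ] K) :
    tensorOp (c • S) T = c • tensorOp S T :=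
  htensor_ext fun x y => by
    simp only [smul_apply, tensorOp_tmul, ← TensorProduct.smul_tmul',
      UniformSpace.Completion.coe_smul]

theorem tensorOp_smul_right (c : ℂ) (S : H →L[ℂ] H) (T : K →L[ℂ] K) :
    tensorOp S (c • T) = c • tensorOp S T :=
  htensor_ext fun x y => by
    simp only [smul_apply, tensorOp_tmul, TensorProduct.tmul_smul,
      UniformSpace.Completion.coe_smul]

theorem tensorOp_sub_left (S S' : H →L[ℂ] H) (T : K →L[ℂ] K) :
    tensorOp (S - S') T = tensorOp S T - tensorOp S' T := by
  rw [eq_sub_iff_add_eq, ← tensorOp_add_left, sub_add_cancel]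

theorem tensorOp_sub_right (S : H →L[ℂ] H) (T T' : K →L[ℂ] K) :
    tensorOp S (T - T') = tensorOp S T - tensorOp S T' := by
  rw [eq_sub_iff_add_eq, ← tensorOp_add_right, sub_add_cancel]

theorem norm_tensorOp_le (S : H →L[ℂ] H) (T : K →L[ℂ] K) : ‖tensorOp S T‖ ≤ ‖S‖ * ‖T‖ := by
  refine ContinuousLinearMap.opNorm_le_bound _ (by positivity) fun x => ?_
  induction x using UniformSpace.Completion.induction_on with
  | hp => exact isClosed_le (by fun_prop) (by fun_prop)
  | ih x =>
    rw [tensorOp_coe, UniformSpace.Completion.norm_coe, UniformSpace.Completion.norm_coe]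
    exact norm_map_le S T x

theorem star_tensorOp (S : H →L[ℂ] H) (T : K →L[ℂ] K) :
    star (tensorOp S T) = tensorOp (star S) (star T) := by
  rw [ContinuousLinearMap.star_eq_adjoint, eq_comm, ContinuousLinearMap.eq_adjoint_iff]
  intro x y
  induction x, y using UniformSpace.Completion.induction_on₂ with
  | hp => exact isClosed_eq (by fun_prop) (by fun_prop)
  | ih x y =>
    rw [tensorOp_coe, tensorOp_coe, UniformSpace.Completion.inner_coe,
      UniformSpace.Completion.inner_coe, inner_map_left, star_star, star_star]

theorem isSelfAdjoint_tensorOp {S : H →L[ℂ] H} {T : K →L[ℂ] K} (hS : IsSelfAdjoint S)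
    (hT : IsSelfAdjoint T) : IsSelfAdjoint (tensorOp S T) := by
  rw [isSelfAdjoint_iff, star_tensorOp, hS.star_eq, hT.star_eq]

theorem tensorOp_isPositive {S : H →L[ℂ] H} {T : K →L[ℂ] K} (hS : S.IsPositive)
    (hT : T.IsPositive) : (tensorOp S T).IsPositive := by
  rw [← ContinuousLinearMap.nonneg_iff_isPositive] at *
  obtain ⟨R, rfl⟩ := CStarAlgebra.nonneg_iff_eq_star_mul_self.mp hS
  obtain ⟨R', rfl⟩ := CStarAlgebra.nonneg_iff_eq_star_mul_self.mp hT
  rw [← tensorOp_mul, ← star_tensorOp]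
  exact star_mul_self_nonneg _

theorem commute_tensorOp (S : H →L[ℂ] H) (T : K →L[ℂ] K) :
    Commute (tensorOp S (1 : K →L[ℂ] K)) (tensorOp (1 : H →L[ℂ] H) T) := by
  rw [Commute, SemiconjBy, tensorOp_mul, tensorOp_mul, mul_one, one_mul, one_mul, mul_one]

omit [CompleteSpace K] in
theorem norm_sum_rankOne_le {ι : Type*} {b : ι → K} (hb : Orthonormal ℂ b) (s : Finset ι) :
    ‖∑ i ∈ s, InnerProductSpace.rankOne ℂ (b i) (b i)‖ ≤ 1 := by
  refine ContinuousLinearMap.opNorm_le_bound _ zero_le_one fun x => ?_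
  rw [one_mul, ← sq_le_sq₀ (norm_nonneg _) (norm_nonneg _)]
  refine le_trans (le_of_eq ?_) (hb.sum_inner_products_le x (s := s))
  simp only [sum_apply, InnerProductSpace.rankOne_apply]
  apply Complex.ofReal_injective
  push_cast
  have h := hb.inner_sum (fun i => ⟪b i, x⟫_ℂ) (fun i => ⟪b i, x⟫_ℂ) s
  rw [inner_self_eq_norm_sq_to_K] at h
  refine h.trans (Finset.sum_congr rfl fun i _ => ?_)
  exact Complex.conj_mul' _

theorem tensorOp_sum_right {ι : Type*} (S : H →L[ℂ] H) (T : ι → K →L[ℂ] K) (s : Finset ι) :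
    tensorOp S (∑ i ∈ s, T i) = ∑ i ∈ s, tensorOp S (T i) := by
  classical
  induction s using Finset.induction_on with
  | empty => simpa using tensorOp_sub_right S (0 : K →L[ℂ] K) 0
  | insert i s hi h => rw [Finset.sum_insert hi, Finset.sum_insert hi, tensorOp_add_right, h]

/-- The operator `S ⊗ |e i⟩⟨e i|` summed over a Hilbert basis is `S ⊗ 1`, strongly. -/
theorem hasSum_tensorOp_rankOne {ι : Type*} (b : HilbertBasis ι ℂ K) (S : H →L[ℂ] H)
    (x : HTensor H K) :
    HasSum (fun i => tensorOp S (InnerProductSpace.rankOne ℂ (b i) (b i)) x) (tensorOp S 1 x) := by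
  let F : Finset ι → HTensor H K →L[ℂ] HTensor H K :=
    fun s => ∑ i ∈ s, tensorOp S (InnerProductSpace.rankOne ℂ (b i) (b i))
  -- The partial sums have norm at most `‖S‖`. This makes the set of convergence closed, so it
  -- suffices to treat algebraic tensors.
  have hF : Equicontinuous ((↑) ∘ F : Finset ι → HTensor H K → HTensor H K) := by
    have h : Equicontinuous ((↑) ∘ F : Finset ι → HTensor H K → HTensor H K) ↔
        ∃ C, ∀ s, ‖F s‖ ≤ C := (NormedSpace.equicontinuous_TFAE F).out 1 5
    refine h.mpr ⟨‖S‖, fun s => ?_⟩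
    change ‖∑ i ∈ s, tensorOp S (InnerProductSpace.rankOne ℂ (b i) (b i))‖ ≤ ‖S‖
    rw [← tensorOp_sum_right]
    refine (norm_tensorOp_le _ _).trans (mul_le_of_le_one_right (norm_nonneg _) ?_)
    exact norm_sum_rankOne_le b.orthonormal s
  have key (x : HTensor H K) : Filter.Tendsto (fun s => F s x) Filter.atTop
      (nhds (tensorOp S 1 x)) := by
    induction x using UniformSpace.Completion.induction_on with
    | hp => exact hF.isClosed_setOfPred_tendsto (tensorOp S 1).continuous
    | ih x =>
      induction x using TensorProduct.induction_on with
      | zero =>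
        have e : ((0 : H ⊗[ℂ] K) : HTensor H K) = 0 := UniformSpace.Completion.coe_zero
        simp [e]
      | add x y hx hy => simpa only [UniformSpace.Completion.coe_add, map_add] using hx.add hy
      | tmul x y =>
        have h : HasSum (fun i => ⟪b i, y⟫_ℂ • b i) y := by
          simpa only [b.repr_apply_apply] using b.hasSum_repr y
        let L : K →L[ℂ] HTensor H K :=
          UniformSpace.Completion.toComplL ∘L TensorProduct.mkL ℂ H K (S x)
        rw [tensorOp_tmul]
        refine ((L.continuous.tendsto _).comp h).congr fun s => ?_
        simp only [F, sum_apply, tensorOp_tmul, InnerProductSpace.rankOne_apply]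
        exact map_sum L _ s
  have := key x
  simp only [F, sum_apply] at this
  exact this

end TensorOp

/-! ### Density operators as ensembles of vectors -/

section Trace

variable {H : Type*} [NormedAddCommGroup H] [InnerProductSpace ℂ H] [CompleteSpace H]

omit [CompleteSpace H] in
theorem _root_.HilbertBasis.hasSum_norm_inner_sq {ι : Type*} (b : HilbertBasis ι ℂ H) (x : H) :
    HasSum (fun i => ‖⟪b i, x⟫_ℂ‖ ^ 2) (‖x‖ ^ 2) := by
  have h := (b.hasSum_inner_mul_inner x x).mapL Complex.reCLM
  convert h using 1
  · ext i
    rw [← inner_conj_symm x, Complex.reCLM_apply, ← Complex.normSq_eq_conj_mul_self,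
      Complex.ofReal_re, Complex.normSq_eq_norm_sq]
  · rw [← inner_self_eq_norm_sq (𝕜 := ℂ)]
    rfl

/-- The vectors are `√ρ e_i` for a Hilbert basis `e`. Both `tr(ρM)` and the ensemble average are
iterated sums of one double series, which is absolutely summable because `√ρ` is Hilbert-Schmidt. -/
theorem DensityOperator.exists_hasSum (ρ : DensityOperator H) :
    ∃ (ι : Set H) (ψ : ι → H), HasSum (fun i => ‖ψ i‖ ^ 2) 1 ∧
      ∀ M : H →L[ℂ] H, HasSum (fun i => ⟪ψ i, M (ψ i)⟫_ℂ) (trace (ρ.op * M)) := by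
  let b := (exists_hilbertBasis ℂ H).choose_spec.choose
  have hρ : 0 ≤ ρ.op := (ContinuousLinearMap.nonneg_iff_isPositive _).mpr ρ.isPositive
  let R := CFC.sqrt ρ.op
  have sR : IsSelfAdjoint R := (CFC.sqrt_nonneg _).isSelfAdjoint
  have hR : R * R = ρ.op := CFC.sqrt_mul_sqrt_self _ hρ
  have iR (x y : H) : ⟪R x, y⟫_ℂ = ⟪x, R y⟫_ℂ := by
    rw [← ContinuousLinearMap.adjoint_inner_right, ← ContinuousLinearMap.star_eq_adjoint,
      sR.star_eq]
  have iρ (x y : H) : ⟪R x, R y⟫_ℂ = ⟪x, ρ.op y⟫_ℂ := by rw [iR, ← hR, mul_apply_eq_comp]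
  have t : ∑' i, ⟪b i, ρ.op (b i)⟫_ℂ = 1 := ρ.trace_eq_one
  have e (i) : ⟪b i, ρ.op (b i)⟫_ℂ = ((‖R (b i)‖ ^ 2 : ℝ) : ℂ) := by
    rw [← iρ, inner_self_eq_norm_sq_to_K]
    push_cast
    rfl
  have s₁ : HasSum (fun i => ‖R (b i)‖ ^ 2) 1 := by
    have : Summable fun i => ⟪b i, ρ.op (b i)⟫_ℂ := by
      -- A divergent sum would take the default value 0, not 1.
      by_contra hn
      rw [tsum_eq_zero_of_not_summable hn] at t
      exact zero_ne_one t
    have := this.hasSum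
    rw [t] at this
    simp only [e] at this
    simpa only [Complex.reCLM_apply, Complex.ofReal_re, Complex.one_re] using
      this.mapL Complex.reCLM
  refine ⟨_, fun i => R (b i), s₁, fun M => ?_⟩
  let F : _ × _ → ℂ := fun p => ⟪b p.2, R (b p.1)⟫_ℂ * ⟪R (b p.1), M (b p.2)⟫_ℂ
  have f₁ (j) : HasSum (fun i => F (j, i)) ⟪R (b j), M (R (b j))⟫_ℂ := by
    have := b.hasSum_inner_mul_inner (star M (R (b j))) (R (b j))
    simp only [ContinuousLinearMap.star_eq_adjoint, ContinuousLinearMap.adjoint_inner_left] at this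
    refine this.congr_fun ?_
    intro i
    exact mul_comm _ _
  have f₂ (i) : HasSum (fun j => F (j, i)) ⟪b i, (ρ.op * M) (b i)⟫_ℂ := by
    have := b.hasSum_inner_mul_inner (R (b i)) (R (M (b i)))
    rw [iρ] at this
    refine this.congr_fun ?_
    intro j
    change ⟪b i, R (b j)⟫_ℂ * _ = _
    rw [← iR (b i), ← iR (b j)]
  have sF : Summable F := by
    have g (j) : HasSum (fun i => (‖⟪b i, R (b j)⟫_ℂ‖ ^ 2 + ‖⟪b i, star M (R (b j))⟫_ℂ‖ ^ 2) / 2)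
        ((‖R (b j)‖ ^ 2 + ‖star M (R (b j))‖ ^ 2) / 2) :=
      ((b.hasSum_norm_inner_sq _).add (b.hasSum_norm_inner_sq _)).div_const 2
    have G : Summable fun p : _ × _ =>
        (‖⟪b p.2, R (b p.1)⟫_ℂ‖ ^ 2 + ‖⟪b p.2, star M (R (b p.1))⟫_ℂ‖ ^ 2) / 2 := by
      rw [summable_prod_of_nonneg fun p => by positivity]
      refine ⟨fun j => (g j).summable, ?_⟩
      simp only [(g _).tsum_eq]
      refine (s₁.summable.add ?_).div_const 2
      refine Summable.of_nonneg_of_le (fun _ => by positivity) (fun j => ?_)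
        (s₁.summable.mul_left (‖star M‖ ^ 2))
      rw [← mul_pow]
      exact pow_le_pow_left₀ (norm_nonneg _) (ContinuousLinearMap.le_opNorm _ _) 2
    refine Summable.of_norm_bounded G fun p => ?_
    have : ‖⟪R (b p.1), M (b p.2)⟫_ℂ‖ = ‖⟪b p.2, star M (R (b p.1))⟫_ℂ‖ := by
      rw [ContinuousLinearMap.star_eq_adjoint, ContinuousLinearMap.adjoint_inner_right,
        ← inner_conj_symm, RCLike.norm_conj]
    rw [norm_mul, this]
    nlinarith [sq_nonneg (‖⟪b p.2, R (b p.1)⟫_ℂ‖ - ‖⟪b p.2, star M (R (b p.1))⟫_ℂ‖)]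
  have h₁ := sF.hasSum.prod_fiberwise f₁
  have h₂ := (sF.prod_symm.hasSum.prod_fiberwise f₂).tsum_eq
  rw [show trace (ρ.op * M) = ∑' i, ⟪b i, (ρ.op * M) (b i)⟫_ℂ from rfl, h₂]
  convert h₁ using 1
  exact (Equiv.prodComm _ _).tsum_eq F

theorem DensityOperator.trace_add (ρ : DensityOperator H) (M N : H →L[ℂ] H) :
    trace (ρ.op * (M + N)) = trace (ρ.op * M) + trace (ρ.op * N) := by
  obtain ⟨ι, ψ, -, h⟩ := ρ.exists_hasSum
  refine (h (M + N)).unique (((h M).add (h N)).congr_fun fun i => ?_)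
  rw [add_apply, inner_add_right]

theorem DensityOperator.trace_smul (ρ : DensityOperator H) (c : ℂ) (M : H →L[ℂ] H) :
    trace (ρ.op * c • M) = c * trace (ρ.op * M) := by
  obtain ⟨ι, ψ, -, h⟩ := ρ.exists_hasSum
  refine (h (c • M)).unique (((h M).mul_left c).congr_fun fun i => ?_)
  rw [smul_apply, inner_smul_right]

theorem DensityOperator.norm_trace_le (ρ : DensityOperator H) (M : H →L[ℂ] H) :
    ‖trace (ρ.op * M)‖ ≤ ‖M‖ := by
  obtain ⟨ι, ψ, h₁, h⟩ := ρ.exists_hasSum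
  have h₂ := h₁.mul_left ‖M‖
  rw [mul_one] at h₂
  rw [← (h M).tsum_eq]
  refine tsum_of_norm_bounded h₂ fun i => (norm_inner_le_norm _ _).trans ?_
  have := mul_le_mul_of_nonneg_left (M.le_opNorm (ψ i)) (norm_nonneg (ψ i))
  linarith

open scoped ComplexOrder in
theorem DensityOperator.trace_nonneg (ρ : DensityOperator H) {M : H →L[ℂ] H} (hM : M.IsPositive) :
    0 ≤ trace (ρ.op * M) := by
  obtain ⟨ι, ψ, -, h⟩ := ρ.exists_hasSum
  rw [← (h M).tsum_eq]
  exact tsum_nonneg fun i => hM.inner_nonneg_right _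

theorem DensityOperator.expect_add (ρ : DensityOperator H) (M N : H →L[ℂ] H) :
    ρ.expect (M + N) = ρ.expect M + ρ.expect N := by
  rw [expect, ρ.trace_add, Complex.add_re, expect, expect]

theorem DensityOperator.expect_smul (ρ : DensityOperator H) (c : ℝ) (M : H →L[ℂ] H) :
    ρ.expect ((c : ℂ) • M) = c * ρ.expect M := by
  rw [expect, ρ.trace_smul, Complex.re_ofReal_mul, expect]

theorem DensityOperator.expect_sub (ρ : DensityOperator H) (M N : H →L[ℂ] H) :
    ρ.expect (M - N) = ρ.expect M - ρ.expect N := by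
  rw [eq_sub_iff_add_eq, ← expect_add, sub_add_cancel]

theorem DensityOperator.expect_one (ρ : DensityOperator H) : ρ.expect 1 = 1 := by
  rw [expect, mul_one, ρ.trace_eq_one, Complex.one_re]

theorem DensityOperator.expect_nonneg (ρ : DensityOperator H) {M : H →L[ℂ] H} (hM : M.IsPositive) :
    0 ≤ ρ.expect M :=
  (Complex.nonneg_iff.mp (ρ.trace_nonneg hM)).1

end Trace

/-! ### Partial traces and their normalization -/

section PartialTrace

variable {H K : Type*} [NormedAddCommGroup H] [InnerProductSpace ℂ H] [CompleteSpace H]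
  [NormedAddCommGroup K] [InnerProductSpace ℂ K] [CompleteSpace K]

/-- The partial trace over the first factor of `ρ (N ⊗ 1)`. -/
theorem DensityOperator.exists_partialTrace (ρ : DensityOperator (HTensor H K)) (N : H →L[ℂ] H) :
    ∃ T : K →L[ℂ] K, ∀ v w, ⟪T v, w⟫_ℂ =
      trace (ρ.op * tensorOp N (InnerProductSpace.rankOne ℂ w v)) := by
  let B : K →ₗ⋆[ℂ] K →ₗ[ℂ] ℂ := LinearMap.mk₂'ₛₗ (starRingEnd ℂ) (RingHom.id ℂ)
    (fun v w => trace (ρ.op * tensorOp N (InnerProductSpace.rankOne ℂ w v)))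
    (fun v v' w => by rw [map_add, tensorOp_add_right, ρ.trace_add])
    (fun c v w => by rw [map_smulₛₗ, tensorOp_smul_right, ρ.trace_smul, smul_eq_mul])
    (fun v w w' => by rw [map_add, add_apply, tensorOp_add_right, ρ.trace_add])
    (fun c v w => by rw [map_smul, smul_apply, tensorOp_smul_right, ρ.trace_smul]; rfl)
  -- The form is bounded by `‖N‖ ‖v‖ ‖w‖`, so the Riesz representation theorem yields the operator.
  refine ⟨InnerProductSpace.continuousLinearMapOfBilin (B.mkContinuous₂ ‖N‖ fun v w => ?_),
    fun v w => InnerProductSpace.continuousLinearMapOfBilin_apply _ v w⟩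
  refine (ρ.norm_trace_le _).trans ((norm_tensorOp_le _ _).trans_eq ?_)
  rw [InnerProductSpace.norm_rankOne]
  ring

/-- Tonelli's theorem for sums. -/
theorem hasSum_swap_of_nonneg {α κ : Type*} {F : α → κ → ℝ} (h₀ : ∀ i j, 0 ≤ F i j) {f : α → ℝ}
    {g : κ → ℝ} {s : ℝ} (hf : ∀ i, HasSum (F i) (f i)) (hg : ∀ j, HasSum (fun i => F i j) (g j))
    (hs : HasSum f s) : HasSum g s := by
  have sF : Summable fun p : α × κ => F p.1 p.2 := by
    rw [summable_prod_of_nonneg fun p => h₀ p.1 p.2]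
    refine ⟨fun i => (hf i).summable, ?_⟩
    simp only [(hf _).tsum_eq]
    exact hs.summable
  have h₁ := hs.unique (sF.hasSum.prod_fiberwise hf)
  have h₂ := sF.prod_symm.hasSum.prod_fiberwise hg
  rw [h₁]
  convert h₂ using 1
  exact ((Equiv.prodComm κ α).tsum_eq fun p : α × κ => F p.1 p.2).symm

theorem DensityOperator.hasSum_trace_tensorOp_rankOne (ρ : DensityOperator (HTensor H K))
    {N : H →L[ℂ] H} (hN : N.IsPositive) {κ : Type*} (b : HilbertBasis κ ℂ K) :
    HasSum (fun i => ρ.expect (tensorOp N (InnerProductSpace.rankOne ℂ (b i) (b i))))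
      (ρ.expect (tensorOp N 1)) := by
  obtain ⟨ι, ψ, -, h⟩ := ρ.exists_hasSum
  have hr (M) : HasSum (fun j => (⟪ψ j, M (ψ j)⟫_ℂ).re) (ρ.expect M) :=
    (h M).mapL Complex.reCLM
  refine hasSum_swap_of_nonneg (fun j i => ?_) (fun j => ?_) (fun i => hr _) (hr (tensorOp N 1))
  · exact (tensorOp_isPositive hN
      (InnerProductSpace.isPositive_rankOne_self (b i))).re_inner_nonneg_right _
  · exact ((hasSum_tensorOp_rankOne b N (ψ j)).mapL (innerSL ℂ (ψ j))).mapL Complex.reCLM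

-- Positivity of `N` makes the partial trace positive, and summing its diagonal over a basis
-- recovers `tr(ρ(N ⊗ 1))`, so dividing by this number gives a state.
open scoped ComplexOrder in
theorem DensityOperator.exists_normalized_partialTrace (ρ : DensityOperator (HTensor H K))
    {N : H →L[ℂ] H} (hN : N.IsPositive) (hr : 0 < ρ.expect (tensorOp N 1)) :
    ∃ σ : DensityOperator K, ∀ v, ρ.expect (tensorOp N (InnerProductSpace.rankOne ℂ v v)) =
      ρ.expect (tensorOp N 1) * (⟪v, σ.op v⟫_ℂ).re := by
  obtain ⟨T, hT⟩ := ρ.exists_partialTrace N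
  set r := ρ.expect (tensorOp N 1)
  have pos (v : K) := ρ.trace_nonneg
    (tensorOp_isPositive hN (InnerProductSpace.isPositive_rankOne_self (𝕜 := ℂ) v))
  have hv (v : K) : ⟪v, T v⟫_ℂ =
      (ρ.expect (tensorOp N (InnerProductSpace.rankOne ℂ v v)) : ℂ) := by
    have h := (Complex.nonneg_iff.mp (pos v)).2
    rw [← inner_conj_symm, hT]
    apply Complex.ext
    · simp [expect]
    · simp [← h]
  have pT : T.IsPositive := by
    rw [ContinuousLinearMap.isPositive_iff_complex]
    intro v
    rw [← inner_conj_symm, hv]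
    simpa using ρ.expect_nonneg
      (tensorOp_isPositive hN (InnerProductSpace.isPositive_rankOne_self (𝕜 := ℂ) v))
  refine ⟨⟨((r⁻¹ : ℝ) : ℂ) • T, pT.smul_of_nonneg ?_, ?_⟩, fun v => ?_⟩
  · exact_mod_cast (inv_pos.mpr hr).le
  · have h := (ρ.hasSum_trace_tensorOp_rankOne hN
      (exists_hilbertBasis ℂ K).choose_spec.choose).mul_left r⁻¹
    rw [inv_mul_cancel₀ hr.ne'] at h
    have h' := (Complex.hasSum_ofReal.mpr h)
    rw [Complex.ofReal_one] at h'
    rw [← h'.tsum_eq]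
    refine tsum_congr fun i => ?_
    rw [smul_apply, inner_smul_right, hv, Complex.ofReal_mul]
  · change _ = r * (⟪v, ((r⁻¹ : ℝ) : ℂ) • T v⟫_ℂ).re
    rw [inner_smul_right, hv, ← Complex.ofReal_mul, Complex.ofReal_re, mul_inv_cancel_left₀ hr.ne']

end PartialTrace

/-! ### Observables of POVMs and the operator form of the biased bound -/

section Observables

variable {H : Type*} [NormedAddCommGroup H] [InnerProductSpace ℂ H] [CompleteSpace H]

/-- The observable with values `1` and `-1` of a measurement. -/
def Measurement.observable (m : Measurement H) : H →L[ℂ] H := m.effect 0 - m.effect 1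

theorem Measurement.effect_add (m : Measurement H) : m.effect 0 + m.effect 1 = 1 := by
  rw [← m.sum_eq_one, Fin.sum_univ_two]

theorem Measurement.isContraction_observable (m : Measurement H) :
    IsContraction m.observable where
  isSelfAdjoint := (m.isPositive 0).isSelfAdjoint.sub (m.isPositive 1).isSelfAdjoint
  norm_le_one := by
    have sA : IsSelfAdjoint m.observable :=
      (m.isPositive 0).isSelfAdjoint.sub (m.isPositive 1).isSelfAdjoint
    have h₀ := (ContinuousLinearMap.nonneg_iff_isPositive _).mpr (m.isPositive 0)
    have h₁ := (ContinuousLinearMap.nonneg_iff_isPositive _).mpr (m.isPositive 1)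
    have e : m.effect 0 = 1 - m.effect 1 := eq_sub_of_add_eq m.effect_add
    let R := CFC.sqrt (m.effect 1)
    have hR : R * R = m.effect 1 := CFC.sqrt_mul_sqrt_self _ h₁
    have sR : IsSelfAdjoint R := (CFC.sqrt_nonneg _).isSelfAdjoint
    have p : 0 ≤ R * m.effect 0 * R := by
      have := star_left_conjugate_nonneg h₀ R
      rwa [sR.star_eq] at this
    -- The effects `P₀ = 1 - P₁` and `P₁` commute, so `1 - (P₀ - P₁)² = 4P₀P₁`; conjugating by `√P₁`
    -- makes it visibly positive.
    have k : 1 - m.observable * m.observable = 4 • (R * m.effect 0 * R) := by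
      rw [observable, e, ← hR]
      noncomm_ring
    have l : ‖m.observable * m.observable‖ ≤ 1 := by
      have q : 0 ≤ m.observable * m.observable := by
        have := star_mul_self_nonneg m.observable
        rwa [sA.star_eq] at this
      rw [CStarAlgebra.norm_le_one_iff_of_nonneg _ q, ← sub_nonneg, k]
      exact nsmul_nonneg p 4
    have := CStarRing.norm_star_mul_self (x := m.observable)
    rw [sA.star_eq] at this
    nlinarith [norm_nonneg m.observable]

/-- An instance of the biased bound as an operator inequality. -/
theorem BiasedBound.isPositive {β s c t : ℝ} {A₀ A₁ B₀ B₁ : H →L[ℂ] H}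
    (h : BiasedBound β s c t A₀ A₁ B₀ B₁)
    (hA₀ : IsSelfAdjoint A₀) (hA₁ : IsSelfAdjoint A₁)
    (hB₀ : IsSelfAdjoint B₀) (hB₁ : IsSelfAdjoint B₁)
    (h₀₀ : Commute A₀ B₀) (h₀₁ : Commute A₀ B₁) (h₁₀ : Commute A₁ B₀) (h₁₁ : Commute A₁ B₁) :
    (((s + c * t ^ 2 : ℝ) : ℂ) • 1 - bellOp (β : ℂ) A₀ A₁ B₀ B₁ - (t : ℂ) • A₁).IsPositive := by
  have sr (r : ℝ) : IsSelfAdjoint (r : ℂ) := Complex.conj_ofReal r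
  rw [ContinuousLinearMap.isPositive_def']
  refine ⟨(((sr _).smul (.one _)).sub ?_).sub ((sr t).smul hA₁), fun ψ => ?_⟩
  · exact (((((sr β).smul hA₀).add ((hA₀.commute_iff hB₀).mp h₀₀)).add
      ((hA₀.commute_iff hB₁).mp h₀₁)).add ((hA₁.commute_iff hB₀).mp h₁₀)).sub
      ((hA₁.commute_iff hB₁).mp h₁₁)
  · have := h ψ
    rw [ContinuousLinearMap.reApplyInnerSelf_apply, inner_re_symm]
    simp only [smul_apply, sub_apply, inner_smul_right, inner_sub_right, RCLike.re_eq_complex_re,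
      Complex.sub_re, Complex.re_ofReal_mul, one_apply_eq_self]
    have e : (⟪ψ, ψ⟫_ℂ).re = ‖ψ‖ ^ 2 := by
      rw [← inner_self_eq_norm_sq (𝕜 := ℂ)]
      rfl
    rw [e]
    linarith

end Observables

/-! ### From devices to operators: winning probability and min-entropy -/

section Devices

variable {HA HB HE : Type*}
  [NormedAddCommGroup HA] [InnerProductSpace ℂ HA] [CompleteSpace HA]
  [NormedAddCommGroup HB] [InnerProductSpace ℂ HB] [CompleteSpace HB]
  [NormedAddCommGroup HE] [InnerProductSpace ℂ HE] [CompleteSpace HE]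

/-- Alice's observable for input `x`, as an operator on the joint space of both devices. -/
def Devices.aliceOp (D : Devices HA HB HE) (x : Fin 2) : HTensor HA HB →L[ℂ] HTensor HA HB :=
  tensorOp (D.alice x).observable 1

/-- Bob's observable for input `y`, as an operator on the joint space of both devices. -/
def Devices.bobOp (D : Devices HA HB HE) (y : Fin 3) : HTensor HA HB →L[ℂ] HTensor HA HB :=
  tensorOp 1 (D.bob y).observable

/-- The tilted CHSH operator of a pair of devices. -/
def Devices.bell (D : Devices HA HB HE) (β : ℝ) : HTensor HA HB →L[ℂ] HTensor HA HB :=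
  bellOp (β : ℂ) (D.aliceOp 0) (D.aliceOp 1) (D.bobOp 0) (D.bobOp 1)

theorem Devices.isContraction_aliceOp (D : Devices HA HB HE) (x : Fin 2) :
    IsContraction (D.aliceOp x) where
  isSelfAdjoint := isSelfAdjoint_tensorOp (D.alice x).isContraction_observable.1 (.one _)
  norm_le_one := (norm_tensorOp_le _ _).trans
    (mul_le_one₀ (D.alice x).isContraction_observable.2 (norm_nonneg _)
      ContinuousLinearMap.norm_id_le)

theorem Devices.isContraction_bobOp (D : Devices HA HB HE) (y : Fin 3) :
    IsContraction (D.bobOp y) where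
  isSelfAdjoint := isSelfAdjoint_tensorOp (.one _) (D.bob y).isContraction_observable.1
  norm_le_one := (norm_tensorOp_le _ _).trans
    (mul_le_one₀ ContinuousLinearMap.norm_id_le (norm_nonneg _)
      (D.bob y).isContraction_observable.2)

theorem Devices.isPositive_bell (D : Devices HA HB HE) {β s : ℝ} (hβ₀ : 0 ≤ β) (hβ₂ : β < 2)
    (hs₀ : 0 ≤ s) (hs : s ^ 2 = 8 + 2 * β ^ 2) (t : ℝ) :
    (((s + (432 / (4 - β ^ 2) ^ 2) ^ 2 * t ^ 2 : ℝ) : ℂ) • 1 - D.bell β -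
      (t : ℂ) • D.aliceOp 1).IsPositive :=
  have hA := D.isContraction_aliceOp
  have hB := D.isContraction_bobOp
  have hc (x : Fin 2) (y : Fin 3) : Commute (D.aliceOp x) (D.bobOp y) := commute_tensorOp _ _
  (biasedBound_of_isContraction hβ₀ hβ₂ hs₀ hs t (hA 0) (hA 1) (hB 0) (hB 1)
    (hc 0 0) (hc 0 1) (hc 1 0) (hc 1 1)).isPositive (hA 0).1 (hA 1).1 (hB 0).1 (hB 1).1
    (hc 0 0) (hc 0 1) (hc 1 0) (hc 1 1)

/-- The expectation of an operator on the joint space of both devices. -/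
def Devices.expectAB (D : Devices HA HB HE) (M : HTensor HA HB →L[ℂ] HTensor HA HB) : ℝ :=
  D.state.expect (tensorOp M 1)

theorem Devices.expectAB_add (D : Devices HA HB HE) (M N : HTensor HA HB →L[ℂ] HTensor HA HB) :
    D.expectAB (M + N) = D.expectAB M + D.expectAB N := by
  rw [expectAB, tensorOp_add_left, DensityOperator.expect_add, expectAB, expectAB]

theorem Devices.expectAB_sub (D : Devices HA HB HE) (M N : HTensor HA HB →L[ℂ] HTensor HA HB) :
    D.expectAB (M - N) = D.expectAB M - D.expectAB N := by
  rw [expectAB, tensorOp_sub_left, DensityOperator.expect_sub, expectAB, expectAB]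

theorem Devices.expectAB_smul (D : Devices HA HB HE) (c : ℝ)
    (M : HTensor HA HB →L[ℂ] HTensor HA HB) : D.expectAB ((c : ℂ) • M) = c * D.expectAB M := by
  rw [expectAB, tensorOp_smul_left, DensityOperator.expect_smul, expectAB]

theorem Devices.expectAB_one (D : Devices HA HB HE) : D.expectAB 1 = 1 := by
  rw [expectAB, tensorOp_one, DensityOperator.expect_one]

theorem Devices.expectAB_nonneg (D : Devices HA HB HE) {M : HTensor HA HB →L[ℂ] HTensor HA HB}
    (hM : M.IsPositive) : 0 ≤ D.expectAB M :=
  D.state.expect_nonneg (tensorOp_isPositive hM ContinuousLinearMap.isPositive_one)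

theorem Devices.sum_prob (D : Devices HA HB HE) (x : Fin 2) (y : Fin 3) :
    D.prob 0 0 x y + D.prob 0 1 x y + D.prob 1 0 x y + D.prob 1 1 x y = 1 := by
  rw [← D.expectAB_one, ← tensorOp_one, ← (D.alice x).effect_add, ← (D.bob y).effect_add]
  simp only [tensorOp_add_left, tensorOp_add_right, expectAB_add]
  simp only [prob, expectAB]
  ring

/-- No-signalling: the left side does not involve `y`, since Bob's effects sum to 1. -/
theorem Devices.expectAB_aliceOp (D : Devices HA HB HE) (x : Fin 2) (y : Fin 3) :
    D.expectAB (D.aliceOp x) =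
      D.prob 0 0 x y + D.prob 0 1 x y - D.prob 1 0 x y - D.prob 1 1 x y := by
  rw [aliceOp, ← (D.bob y).effect_add, Measurement.observable]
  simp only [tensorOp_sub_left, tensorOp_add_right, expectAB_add, expectAB_sub]
  simp only [prob, expectAB]
  ring

theorem Devices.expectAB_mul (D : Devices HA HB HE) (x : Fin 2) (y : Fin 3) :
    D.expectAB (D.aliceOp x * D.bobOp y) =
      D.prob 0 0 x y - D.prob 0 1 x y - D.prob 1 0 x y + D.prob 1 1 x y := by
  rw [aliceOp, bobOp, tensorOp_mul, mul_one, one_mul, Measurement.observable,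
    Measurement.observable]
  simp only [tensorOp_sub_left, tensorOp_sub_right, expectAB_sub]
  simp only [prob, expectAB]
  ring

theorem Devices.winProb_eq (D : Devices HA HB HE) {β : ℝ} (hβ₀ : 0 ≤ β) :
    D.winProb β = 1 / 2 + D.expectAB (D.bell β) / (8 + 2 * β) := by
  have h₀₀ := D.sum_prob 0 0
  have h₀₁ := D.sum_prob 0 1
  have h₁₀ := D.sum_prob 1 0
  have h₁₁ := D.sum_prob 1 1
  have h₀₂ := D.sum_prob 0 2
  have h : D.winProb β = (4 + β)⁻¹ * (D.prob 0 0 0 0 + D.prob 1 1 0 0 + D.prob 0 0 0 1 +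
      D.prob 1 1 0 1 + D.prob 0 0 1 0 + D.prob 1 1 1 0 + D.prob 0 1 1 1 + D.prob 1 0 1 1 +
      β * (D.prob 0 0 0 2 + D.prob 0 1 0 2)) := by
    simp [winProb, Fin.sum_univ_succ, predicate, inputDist]
    ring
  have hb : D.expectAB (D.bell β) = β * D.expectAB (D.aliceOp 0) +
      D.expectAB (D.aliceOp 0 * D.bobOp 0) + D.expectAB (D.aliceOp 0 * D.bobOp 1) +
      D.expectAB (D.aliceOp 1 * D.bobOp 0) - D.expectAB (D.aliceOp 1 * D.bobOp 1) := by
    simp only [bell, bellOp, expectAB_add, expectAB_sub, expectAB_smul]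
  -- The tilt is tested with Bob's input 2, so Alice's marginal is expanded with that input.
  rw [h, hb, D.expectAB_aliceOp 0 2]
  simp only [expectAB_mul]
  have hn : 4 + β ≠ 0 := by linarith
  rw [show 8 + 2 * β = 2 * (4 + β) by ring]
  field_simp
  linear_combination h₀₀ + h₀₁ + h₁₀ + h₁₁ + β * h₀₂

theorem Devices.envForm_le (D : Devices HA HB HE) {N : HTensor HA HB →L[ℂ] HTensor HA HB}
    (h₁ : (N - (1 + D.aliceOp 1)).IsPositive) (h₂ : (N - (1 - D.aliceOp 1)).IsPositive)
    (a : Fin 2) (v : HE) :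
    2 * D.envForm 1 a v ≤ D.state.expect (tensorOp N (InnerProductSpace.rankOne ℂ v v)) := by
  -- Twice the effect of outcome 0 or 1 is `1 + A₁` or `1 - A₁`.
  have e : (N - ((2 : ℝ) : ℂ) • tensorOp ((D.alice 1).effect a) 1).IsPositive := by
    have k : (1 : HTensor HA HB →L[ℂ] HTensor HA HB) =
        tensorOp ((D.alice 1).effect 0) 1 + tensorOp ((D.alice 1).effect 1) 1 := by
      rw [← tensorOp_add_left, Measurement.effect_add, tensorOp_one]
    rw [aliceOp, Measurement.observable, tensorOp_sub_left, k] at h₁ h₂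
    obtain rfl | rfl : a = 0 ∨ a = 1 := by omega
    · convert h₁ using 1
      push_cast
      module
    · convert h₂ using 1
      push_cast
      module
  have := D.state.expect_nonneg (tensorOp_isPositive e
    (InnerProductSpace.isPositive_rankOne_self (𝕜 := ℂ) v))
  rw [tensorOp_sub_left, tensorOp_smul_left, DensityOperator.expect_sub,
    DensityOperator.expect_smul] at this
  exact sub_nonneg.mp this

/-- The min-entropy is bounded below if `N` dominates both of Alice's effects for input `1`. -/
theorem Devices.le_minEntropy (D : Devices HA HB HE) {N : HTensor HA HB →L[ℂ] HTensor HA HB}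
    (hN : N.IsPositive)
    (h₁ : (N - (1 + D.aliceOp 1)).IsPositive) (h₂ : (N - (1 - D.aliceOp 1)).IsPositive) {y : ℝ}
    (h₀ : 0 < D.expectAB N) (hy : D.expectAB N ≤ 1 + y) :
    ((1 - y / Real.log 2 : ℝ) : EReal) ≤ D.minEntropy 1 := by
  refine le_sSup ⟨_, rfl, ?_⟩
  obtain ⟨σ, hσ⟩ := D.state.exists_normalized_partialTrace hN h₀
  refine ⟨σ, fun a v => ?_⟩
  -- The value of `h` is chosen so that `2 ^ (-h) = exp y / 2`, which is at least `(1 + y) / 2`.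
  have e : (2 : ℝ) ^ (-(1 - y / Real.log 2)) = Real.exp y / 2 := by
    have hl : Real.log 2 ≠ 0 := (Real.log_pos one_lt_two).ne'
    rw [Real.rpow_def_of_pos two_pos, show Real.log 2 * -(1 - y / Real.log 2) = y - Real.log 2 by
      field_simp; ring, Real.exp_sub, Real.exp_log two_pos]
  have b := D.envForm_le h₁ h₂ a v
  have p : 0 ≤ (⟪v, σ.op v⟫_ℂ).re := σ.isPositive.re_inner_nonneg_right v
  have q := mul_le_mul_of_nonneg_right (hy.trans ((add_comm _ _).trans_le (Real.add_one_le_exp y))) p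
  rw [hσ v] at b
  rw [e]
  change _ ≤ D.expectAB N * _ at b
  linarith

end Devices

/-! ### Comparison with the angle, and the final estimates -/

/-- For `β ≤ 1` it suffices that `θ ≤ 1` and `4 - β² ≥ 3`. For `β ≥ 1`, `arctan u ≤ u` gives `θ⁴ ≤
(4 - β²)² / 64`. -/
theorem angle_pos_and_pow_four_le {β : ℝ} (hβ₀ : 0 ≤ β) (hβ₂ : β < 2) :
    0 < angle β ∧ angle β ^ 4 ≤ (4 - β ^ 2) ^ 2 / 9 := by
  have hpi : Real.pi < 4 := Real.pi_lt_four
  have small {θ : ℝ} (h₀ : 0 < θ) (h₁ : θ ≤ 1) (hβ : β ≤ 1) : θ ^ 4 ≤ (4 - β ^ 2) ^ 2 / 9 := by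
    refine (pow_le_one₀ h₀.le h₁).trans ?_
    have : 3 ≤ 4 - β ^ 2 := by nlinarith
    nlinarith
  rcases eq_or_ne β 0 with rfl | hne
  · have h₀ : 0 < angle 0 := by simp [angle, Real.pi_pos]
    have h₁ : angle 0 ≤ 1 := by rw [angle, if_pos rfl]; linarith
    exact ⟨h₀, small h₀ h₁ zero_le_one⟩
  have hpos : 0 < β := lt_of_le_of_ne hβ₀ hne.symm
  have hu : 2 / β ^ 2 - 1 / 2 = (4 - β ^ 2) / (2 * β ^ 2) := by field_simp; ring
  have hg : 0 < 4 - β ^ 2 := by nlinarith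
  have hu₀ : 0 < 2 / β ^ 2 - 1 / 2 := by rw [hu]; positivity
  have ha : angle β = Real.arctan (√(2 / β ^ 2 - 1 / 2)) / 2 := if_neg hne
  have h₀ : 0 < angle β := by
    rw [ha]
    exact half_pos (Real.arctan_pos.mpr (Real.sqrt_pos.mpr hu₀))
  refine ⟨h₀, ?_⟩
  rcases le_total β 1 with hβ | hβ
  · refine small h₀ ?_ hβ
    have := Real.arctan_lt_pi_div_two (√(2 / β ^ 2 - 1 / 2))
    rw [ha]
    linarith
  · have h₁ : angle β ≤ √(2 / β ^ 2 - 1 / 2) / 2 := by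
      rw [ha]
      have := Real.le_tan (Real.arctan_nonneg.mpr (Real.sqrt_nonneg (2 / β ^ 2 - 1 / 2)))
        (Real.arctan_lt_pi_div_two _)
      rw [Real.tan_arctan] at this
      linarith
    have h₂ : 2 / β ^ 2 - 1 / 2 ≤ (4 - β ^ 2) / 2 := by
      rw [hu]
      exact div_le_div_of_nonneg_left hg.le two_pos (by nlinarith)
    calc angle β ^ 4 ≤ (√(2 / β ^ 2 - 1 / 2) / 2) ^ 4 := pow_le_pow_left₀ h₀.le h₁ 4
      _ = (2 / β ^ 2 - 1 / 2) ^ 2 / 16 := by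
        rw [div_pow, show 4 = 2 * 2 from rfl, pow_mul, Real.sq_sqrt hu₀.le]; norm_num
      _ ≤ ((4 - β ^ 2) / 2) ^ 2 / 16 := by gcongr
      _ ≤ _ := by nlinarith [sq_nonneg (4 - β ^ 2)]

variable {HA HB HE : Type*}
  [NormedAddCommGroup HA] [InnerProductSpace ℂ HA] [CompleteSpace HA]
  [NormedAddCommGroup HB] [InnerProductSpace ℂ HB] [CompleteSpace HB]
  [NormedAddCommGroup HE] [InnerProductSpace ℂ HE] [CompleteSpace HE]

/-- Tsirelson's bound for the tilted CHSH operator. -/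
theorem Devices.expectAB_bell_le (D : Devices HA HB HE) {β s : ℝ} (hβ₀ : 0 ≤ β) (hβ₂ : β < 2)
    (hs₀ : 0 ≤ s) (hs : s ^ 2 = 8 + 2 * β ^ 2) : D.expectAB (D.bell β) ≤ s := by
  have := D.expectAB_nonneg (D.isPositive_bell hβ₀ hβ₂ hs₀ hs 0)
  rw [expectAB_sub, expectAB_sub, expectAB_smul, expectAB_smul, expectAB_one] at this
  linarith

-- A strict bound `δ` on the gap keeps `t` positive, so that `N` can be formed even for optimal
-- devices.
open scoped ComplexOrder in
theorem Devices.le_minEntropy_of_lt (D : Devices HA HB HE) {β s δ : ℝ} (hβ₀ : 0 ≤ β) (hβ₂ : β < 2)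
    (hs₀ : 0 ≤ s) (hs : s ^ 2 = 8 + 2 * β ^ 2) (hδ : s - D.expectAB (D.bell β) < δ) :
    ((1 - 2 * (432 / (4 - β ^ 2) ^ 2) * √δ / Real.log 2 : ℝ) : EReal) ≤ D.minEntropy 1 := by
  have hg : 0 < 4 - β ^ 2 := by nlinarith
  obtain ⟨c, hc⟩ : ∃ c, c = 432 / (4 - β ^ 2) ^ 2 := ⟨_, rfl⟩
  have hc₀ : 0 < c := by rw [hc]; positivity
  rw [← hc]
  have hE := D.expectAB_bell_le hβ₀ hβ₂ hs₀ hs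
  have hδ₀ : 0 < δ := by linarith
  -- This choice minimizes `δ / t + c²t`, with minimum `2c√δ`.
  set t := √δ / c with ht
  have hsδ : 0 < √δ := Real.sqrt_pos.mpr hδ₀
  have ht₀ : 0 < t := div_pos hsδ hc₀
  have htc : c ^ 2 * t ^ 2 = δ := by
    rw [ht, div_pow, Real.sq_sqrt hδ₀.le]
    field_simp
  have ti : ((t⁻¹ : ℝ) : ℂ) * (t : ℂ) = 1 := by
    rw [← Complex.ofReal_mul, inv_mul_cancel₀ ht₀.ne', Complex.ofReal_one]
  have ti₀ : (0 : ℂ) ≤ ((t⁻¹ : ℝ) : ℂ) := by exact_mod_cast (inv_pos.mpr ht₀).le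
  have p₁ := D.isPositive_bell hβ₀ hβ₂ hs₀ hs t
  have p₂ := D.isPositive_bell hβ₀ hβ₂ hs₀ hs (-t)
  have p₃ := D.isPositive_bell hβ₀ hβ₂ hs₀ hs 0
  rw [← hc, htc] at p₁
  rw [← hc, neg_sq, htc] at p₂
  rw [← hc] at p₃
  let X := ((s + δ : ℝ) : ℂ) • (1 : HTensor HA HB →L[ℂ] HTensor HA HB) - D.bell β
  let N := 1 + ((t⁻¹ : ℝ) : ℂ) • X
  have h₁ : (N - (1 + D.aliceOp 1)).IsPositive := by
    convert p₁.smul_of_nonneg ti₀ using 1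
    rw [smul_sub, smul_smul, ti, one_smul]
    simp only [N, X]
    abel
  have h₂ : (N - (1 - D.aliceOp 1)).IsPositive := by
    convert p₂.smul_of_nonneg ti₀ using 1
    rw [Complex.ofReal_neg, neg_smul, sub_neg_eq_add, smul_add, smul_smul, ti, one_smul]
    simp only [N, X]
    abel
  have hN : N.IsPositive := by
    have hX : X.IsPositive := by
      have e : X = (((s + c ^ 2 * 0 ^ 2 : ℝ) : ℂ) • 1 - D.bell β - ((0 : ℝ) : ℂ) • D.aliceOp 1) +
          (δ : ℂ) • 1 := by
        simp only [X]
        push_cast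
        module
      rw [e]
      exact p₃.add (ContinuousLinearMap.isPositive_one.smul_of_nonneg (by exact_mod_cast hδ₀.le))
    exact ContinuousLinearMap.isPositive_one.add (hX.smul_of_nonneg ti₀)
  have eN : D.expectAB N = 1 + t⁻¹ * (s + δ - D.expectAB (D.bell β)) := by
    simp only [N, X, expectAB_add, expectAB_sub, expectAB_smul, expectAB_one, mul_one]
  refine D.le_minEntropy hN h₁ h₂ ?_ ?_
  · rw [eN]
    have : 0 < t⁻¹ * (s + δ - D.expectAB (D.bell β)) := mul_pos (inv_pos.mpr ht₀) (by linarith)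
    linarith
  · rw [eN]
    have h : t⁻¹ * (s + δ - D.expectAB (D.bell β)) ≤ t⁻¹ * (2 * δ) :=
      mul_le_mul_of_nonneg_left (by linarith) (inv_pos.mpr ht₀).le
    have h' : t⁻¹ * (2 * δ) = 2 * c * √δ := by
      rw [ht, inv_div]
      field_simp
      rw [Real.sq_sqrt hδ₀.le]
    linarith

/-- Continuity of the bound lets `δ` decrease to the exact gap, which may be 0. -/
theorem Devices.le_minEntropy_expectAB (D : Devices HA HB HE) {β s : ℝ} (hβ₀ : 0 ≤ β)
    (hβ₂ : β < 2) (hs₀ : 0 ≤ s) (hs : s ^ 2 = 8 + 2 * β ^ 2) :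
    ((1 - 2 * (432 / (4 - β ^ 2) ^ 2) * √(s - D.expectAB (D.bell β)) / Real.log 2 : ℝ) : EReal) ≤
      D.minEntropy 1 := by
  set δ := s - D.expectAB (D.bell β)
  have hc : Continuous fun x : ℝ =>
      ((1 - 2 * (432 / (4 - β ^ 2) ^ 2) * √x / Real.log 2 : ℝ) : EReal) :=
    continuous_coe_real_ereal.comp (by fun_prop)
  refine le_of_tendsto ((hc.tendsto δ).mono_left nhdsWithin_le_nhds)
    (f := fun x : ℝ => ((1 - 2 * (432 / (4 - β ^ 2) ^ 2) * √x / Real.log 2 : ℝ) : EReal))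
    (x := nhdsWithin δ (Set.Ioi δ)) ?_
  filter_upwards [self_mem_nhdsWithin] with x hx
  exact D.le_minEntropy_of_lt hβ₀ hβ₂ hs₀ hs hx

theorem constant_le (β : ℝ) :
    4 * √(4 + β) * (4 * √2 + 61) / Real.log 2 ≤ 385 * √(4 + β) := by
  have hl := Real.log_two_gt_d9
  have h2 : √2 ≤ 1.41422 := Real.sqrt_le_iff.mpr (by norm_num)
  rw [div_le_iff₀ (by linarith)]
  have := mul_le_mul_of_nonneg_left (show 4 * (4 * √2 + 61) ≤ 385 * Real.log 2 by linarith)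
    (Real.sqrt_nonneg (4 + β))
  linarith

theorem coefficient_le {β : ℝ} (hβ₀ : 0 ≤ β) (hβ₂ : β < 2) (x : ℝ) :
    2 * (432 / (4 - β ^ 2) ^ 2) * √((8 + 2 * β) * x) / Real.log 2 ≤
      4 * √(4 + β) * (4 * √2 + 61) / Real.log 2 * (angle β ^ 4)⁻¹ * √x := by
  obtain ⟨h₀, h₁⟩ := angle_pos_and_pow_four_le hβ₀ hβ₂
  have hg : 0 < 4 - β ^ 2 := by nlinarith
  have h2 : √2 ≤ 1.5 := Real.sqrt_le_iff.mpr (by norm_num)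
  have h2' := Real.sqrt_nonneg 2
  have hθ : 9 / (4 - β ^ 2) ^ 2 ≤ (angle β ^ 4)⁻¹ := by
    rw [← inv_div]
    exact inv_anti₀ (by positivity) h₁
  have hinv : 0 < (angle β ^ 4)⁻¹ := by positivity
  have key : 2 * (432 / (4 - β ^ 2) ^ 2) * √2 ≤ 4 * (4 * √2 + 61) * (angle β ^ 4)⁻¹ := by
    -- Since `864 = 96 · 9`, the claim reduces to `96√2 ≤ 4(4√2 + 61)`.
    calc 2 * (432 / (4 - β ^ 2) ^ 2) * √2 = (96 * √2) * (9 / (4 - β ^ 2) ^ 2) := by ring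
      _ ≤ (4 * (4 * √2 + 61)) * (angle β ^ 4)⁻¹ :=
        mul_le_mul (by linarith) hθ (by positivity) (by positivity)
  have hl : 0 < Real.log 2 := Real.log_pos one_lt_two
  rw [show (8 + 2 * β) * x = 2 * (4 + β) * x by ring, Real.sqrt_mul (by positivity),
    Real.sqrt_mul two_pos.le]
  have := mul_le_mul_of_nonneg_right key
    (show 0 ≤ √(4 + β) * √x / Real.log 2 by positivity)
  calc _ = 2 * (432 / (4 - β ^ 2) ^ 2) * √2 * (√(4 + β) * √x / Real.log 2) := by ring
    _ ≤ _ := this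
    _ = _ := by ring

end TiltedCHSH

end

theorem lemma2 (β : ℝ) (hβ₀ : 0 ≤ β) (hβ₂ : β < 2) :
    4 * √(4 + β) * (4 * √2 + 61) / Real.log 2 ≤ 385 * √(4 + β) ∧
    ∃ κ : ℝ, κ ≤ 4 * √(4 + β) * (4 * √2 + 61) / Real.log 2 ∧
      ∀ (HA HB HE : Type*)
        [NormedAddCommGroup HA] [InnerProductSpace ℂ HA] [CompleteSpace HA]
        [NormedAddCommGroup HB] [InnerProductSpace ℂ HB] [CompleteSpace HB]
        [NormedAddCommGroup HE] [InnerProductSpace ℂ HE] [CompleteSpace HE]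
        (D : TiltedCHSH.Devices HA HB HE),
        D.winProb β ≤ TiltedCHSH.quantumValue β ∧
        ((1 - κ * (TiltedCHSH.angle β ^ 4)⁻¹ *
            √(TiltedCHSH.quantumValue β - D.winProb β) : ℝ) : EReal) ≤ D.minEntropy 1 := by
  -- The upper bound itself is taken as `κ`.
  refine ⟨TiltedCHSH.constant_le β, _, le_rfl, ?_⟩
  intro HA HB HE _ _ _ _ _ _ _ _ _ D
  have hs₀ := Real.sqrt_nonneg (8 + 2 * β ^ 2)
  have hs : √(8 + 2 * β ^ 2) ^ 2 = 8 + 2 * β ^ 2 := Real.sq_sqrt (by positivity)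
  have h := D.expectAB_bell_le hβ₀ hβ₂ hs₀ hs
  have hn : 0 < 8 + 2 * β := by linarith
  have e : TiltedCHSH.quantumValue β - D.winProb β =
      (√(8 + 2 * β ^ 2) - D.expectAB (D.bell β)) / (8 + 2 * β) := by
    rw [TiltedCHSH.quantumValue, D.winProb_eq hβ₀]
    ring
  refine ⟨?_, ?_⟩
  · rw [← sub_nonneg, e]
    exact div_nonneg (sub_nonneg.mpr h) hn.le
  · refine le_trans ?_ (D.le_minEntropy_expectAB hβ₀ hβ₂ hs₀ hs)
    have := TiltedCHSH.coefficient_le hβ₀ hβ₂ (TiltedCHSH.quantumValue β - D.winProb β)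
    rw [e, mul_div_cancel₀ _ hn.ne'] at this
    rw [EReal.coe_le_coe_iff, e]
    linarith
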